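/- Let $n, e_1, e_2$ be non-negative integers with $e_1 \le e_2 \le n$. Let $J_n(0)$ be the nilpotent $n\times n$ Jordan block and let $R_n = (\mathbf{C}^n, \mathbf{C}^n, \mathrm{Id}, J_n(0))$ be the corresponding regular indecomposable complex representation of the Kronecker quiver $1 \rightrightarrows 2$ (the zero representation if $n=0$). Let $$Gr_{(e_1,e_2)}(R_n) = \{(N_1,N_2)\in Gr_{e_1}(\mathbf{C}^n)\times Gr_{e_2}(\mathbf{C}^n) :\ N_1\subseteq N_2,\ J_n(0)N_1\subseteq N_2\}$$ be the quiver Grassmannian of subrepresentations of $R_n$ of dimension vector $\mathbf{e}=(e_1,e_2)$, where $Gr_e(V)$ is the Grassmannian of $e$-dimensional subspaces of $V$; it is a closed subvariety of the projective variety $Gr_{e_1}(\mathbf{C}^n)\times Gr_{e_2}(\mathbf{C}^n)$. Let $\delta=(1,1)$ and let $\langle (a,b),(c,d)\rangle = ac+bd-2ad$ be the Euler form of the Kronecker quiver. Then the dimension of the variety $Gr_{(e_1,e_2)}(R_n)$ (the Krull dimension of its Zariski topology) is $$\dim Gr_{(e_1,e_2)}(R_n) = \langle \mathbf{e},\, n\delta-\mathbf{e}\rangle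 = (e_2-e_1)\bigl(n-(e_2-e_1)\bigr).$$ -/

import Mathlib

namespace KroneckerQuiver

/-- A complex representation of the Kronecker quiver (two vertices `1`, `2` and two arrows
`a, b : 1 → 2`) on the coordinate spaces `M₁ = ℂ^d₁` and `M₂ = ℂ^d₂`. -/
structure Rep (d₁ d₂ : ℕ) where
  /-- the linear map `m_a : M₁ → M₂` -/
  a : (Fin d₁ → ℂ) →ₗ[ℂ] (Fin d₂ → ℂ)
  /-- the linear map `m_b : M₁ → M₂` -/
  b : (Fin d₁ → ℂ) →ₗ[ℂ] (Fin d₂ → ℂ)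

/-- The nilpotent Jordan block `J_n(0)`, with the convention `J v_k = v_{k+1}`, `J v_n = 0`
on the standard basis. -/
def nilpotentJordan (n : ℕ) : Matrix (Fin n) (Fin n) ℂ :=
  Matrix.of fun i j => if (i : ℕ) = (j : ℕ) + 1 then 1 else 0

/-- The indecomposable regular representation `R_n = (ℂ^n, ℂ^n, Id, J_n(0))`. -/
def regularRep (n : ℕ) : Rep n n where
  a := LinearMap.id
  b := Matrix.toLin' (nilpotentJordan n)

/-- The points of the product of Grassmannians `Gr_{e₁}(ℂ^d₁) × Gr_{e₂}(ℂ^d₂)`: pairs of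
vector subspaces of dimensions `e₁` and `e₂`. It carries the Zariski topology below. -/
@[ext]
structure GrassmannianPair (d₁ d₂ e₁ e₂ : ℕ) where
  N₁ : Submodule ℂ (Fin d₁ → ℂ)
  N₂ : Submodule ℂ (Fin d₂ → ℂ)
  finrank_N₁ : Module.finrank ℂ N₁ = e₁
  finrank_N₂ : Module.finrank ℂ N₂ = e₂

/-- The Plücker coordinates of a subspace `N ⊆ ℂ^d` with respect to a basis of `N`: the maximal
minors of the `d × e` matrix whose columns are the basis vectors. Changing the basis multiplies
all of them by one common nonzero scalar. -/
noncomputable def plucker {d e : ℕ} {N : Submodule ℂ (Fin d → ℂ)}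
    (v : Module.Basis (Fin e) ℂ N) (I : Fin e ↪o Fin d) : ℂ :=
  (Matrix.of fun i j : Fin e => (v j : Fin d → ℂ) (I i)).det

/-- A polynomial in two groups of variables is bihomogeneous of bidegree `(p, q)`. -/
def IsBihomogeneous {σ τ : Type} (F : MvPolynomial (σ ⊕ τ) ℂ) (p q : ℕ) : Prop :=
  MvPolynomial.IsWeightedHomogeneous (Sum.elim (fun _ => 1) (fun _ => 0) : σ ⊕ τ → ℕ) F p ∧
    MvPolynomial.IsWeightedHomogeneous (Sum.elim (fun _ => 0) (fun _ => 1) : σ ⊕ τ → ℕ) F q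

/-- The locus in `Gr_{e₁}(ℂ^d₁) × Gr_{e₂}(ℂ^d₂)` where a polynomial in the Plücker coordinates
of the two factors does not vanish. If the polynomial is bihomogeneous, then its vanishing does
not depend on the bases chosen. -/
def nonvanishingLocus {d₁ d₂ e₁ e₂ : ℕ}
    (F : MvPolynomial ((Fin e₁ ↪o Fin d₁) ⊕ (Fin e₂ ↪o Fin d₂)) ℂ) :
    Set (GrassmannianPair d₁ d₂ e₁ e₂) :=
  {N | ∃ (v : Module.Basis (Fin e₁) ℂ N.N₁) (w : Module.Basis (Fin e₂) ℂ N.N₂),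
    MvPolynomial.eval (Sum.elim (plucker v) (plucker w)) F ≠ 0}

/-- The Zariski topology on `Gr_{e₁}(ℂ^d₁) × Gr_{e₂}(ℂ^d₂)`, a projective variety by the Plücker
embeddings of both factors into projective spaces: the nonvanishing loci of the bihomogeneous
polynomials in the Plücker coordinates form a basis of the open sets. -/
instance zariskiTopology (d₁ d₂ e₁ e₂ : ℕ) :
    TopologicalSpace (GrassmannianPair d₁ d₂ e₁ e₂) :=
  TopologicalSpace.generateFrom
    {U | ∃ (p q : ℕ) (F : MvPolynomial ((Fin e₁ ↪o Fin d₁) ⊕ (Fin e₂ ↪o Fin d₂)) ℂ),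
      IsBihomogeneous F p q ∧ U = nonvanishingLocus F}

/-- The quiver Grassmannian `Gr_{(e₁,e₂)}(M)` of subrepresentations of `M` of dimension vector
`(e₁, e₂)`, as a subset of the product of Grassmannians. -/
def quiverGrassmannian {d₁ d₂ : ℕ} (M : Rep d₁ d₂) (e₁ e₂ : ℕ) :
    Set (GrassmannianPair d₁ d₂ e₁ e₂) :=
  {N | (∀ x ∈ N.N₁, M.a x ∈ N.N₂) ∧ (∀ x ∈ N.N₁, M.b x ∈ N.N₂)}

/-- The Euler form of the Kronecker quiver. -/
def eulerForm (e f : ℤ × ℤ) : ℤ :=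
  e.1 * f.1 + e.2 * f.2 - 2 * e.1 * f.2

/-- The dimension vector `δ = (1, 1)`. -/
def delta : ℤ × ℤ := (1, 1)

end KroneckerQuiver

/-! Put f = e₂ - e₁. The asserted dimension is f(n - f), and the two inequalities are proved
separately.

Upper bound. Choose reduced echelon bases v of N₁ and w of N₂, and sort the points into finitely
many cells by the pivot sets S₁, S₂. Comparing leading positions, N₁ ⊆ N₂ gives S₁ ⊆ S₂, and J N₁ ⊆
N₂ gives S₁ + 1 ⊆ S₂ as far as it stays in range. On a cell, v is determined by w and by the entries
of v at the positions S₂ \ S₁, at most e₁f of them. The relation J N₁ ⊆ N₂ determines recursively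
every row of w whose pivot lies in S₁ + 1, which leaves at most f rows with at most n - e₂ free
entries each (`mem_subalgebra_of_free_entries`, `card_freeEntry_le`). The sum is f(n - f). The cells
need no topological property: a chain of m + 1 irreducible closed sets gives m algebraically
independent functions (`exists_algIndepOn_of_chain`), they stay independent on one cell, and there
they are rational in the free entries, so transcendence degree bounds m (`AlgIndepOn.le_card`).

Lower bound. For f > 0 an affine space of dimension e₁f + f(n - e₂) maps to the quiver Grassmannian
(`family`) so that each parameter is, up to sign, a Plücker coordinate. The coordinate flag then
yields a strict chain of irreducible closed sets (`le_topologicalKrullDim_of_param`). For f = 0 a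
single point suffices. -/

namespace KroneckerQuiver

/-! ### Upper bounds for Krull dimension by algebraic independence. -/

/-- Algebraic independence over `ℂ` of the restrictions of functions to a set. -/
def AlgIndepOn {X ι : Type*} (f : ι → X → ℂ) (T : Set X) : Prop :=
  ∀ P : MvPolynomial ι ℂ, (∀ x ∈ T, MvPolynomial.eval (fun i => f i x) P = 0) → P = 0

theorem eval_mem_subalgebra {X ι : Type*} (A : Subalgebra ℂ (X → ℂ)) {f : ι → X → ℂ}
    (hf : ∀ i, f i ∈ A) (P : MvPolynomial ι ℂ) :
    (fun x => MvPolynomial.eval (fun i => f i x) P) ∈ A := by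
  induction P using MvPolynomial.induction_on with
  | C a => simp only [MvPolynomial.eval_C]; exact A.algebraMap_mem a
  | add p q hp hq => simp only [map_add]; exact A.add_mem hp hq
  | mul_X p i hp => simp only [map_mul, MvPolynomial.eval_X]; exact A.mul_mem hp (hf i)

theorem trdeg_fractionRing_mvPolynomial (τ : Type) [Fintype τ] :
    Algebra.trdeg ℂ (FractionRing (MvPolynomial τ ℂ)) = Fintype.card τ := by
  have h := trdeg_add_eq ℂ (MvPolynomial τ ℂ) (A := FractionRing (MvPolynomial τ ℂ))
  have h0 : Algebra.trdeg (MvPolynomial τ ℂ) (FractionRing (MvPolynomial τ ℂ)) = 0 := by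
    have := IsLocalization.isAlgebraic (R := MvPolynomial τ ℂ)
      (S := FractionRing (MvPolynomial τ ℂ)) (nonZeroDivisors (MvPolynomial τ ℂ))
    exact _root_.trdeg_eq_zero
  rw [h0, add_zero, MvPolynomial.trdeg_of_isDomain] at h
  simpa using h.symm

/-- Functions that are rational in the coordinates `g`, with a common denominator, cannot
outnumber these coordinates if they are algebraically independent. -/
theorem AlgIndepOn.le_card {X τ : Type} [Fintype τ] {m : ℕ} {f : Fin m → X → ℂ} {T : Set X}
    (hf : AlgIndepOn f T) (g : X → τ → ℂ) (H : MvPolynomial τ ℂ)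
    (hH : ∀ x ∈ T, MvPolynomial.eval (g x) H ≠ 0)
    (hrat : ∀ i, ∃ (N : ℕ) (G : MvPolynomial τ ℂ), ∀ x ∈ T,
      f i x * MvPolynomial.eval (g x) H ^ N = MvPolynomial.eval (g x) G) :
    m ≤ Fintype.card τ := by
  classical
  obtain ⟨x₀, hx₀⟩ : T.Nonempty := by
    by_contra h
    rw [Set.not_nonempty_iff_eq_empty] at h
    exact one_ne_zero (hf 1 (by simp [h]))
  have hH0 : H ≠ 0 := fun h => hH x₀ hx₀ (by simp [h])
  choose N G hG using hrat
  let K := FractionRing (MvPolynomial τ ℂ)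
  let φ : MvPolynomial τ ℂ →ₐ[ℂ] K := IsScalarTower.toAlgHom ℂ _ K
  have hφ : Function.Injective φ := IsFractionRing.injective (MvPolynomial τ ℂ) K
  have hφH : φ H ≠ 0 := fun h => hH0 (hφ (by simpa using h))
  let r : Fin m → K := fun i => φ (G i) / φ H ^ N i
  -- One numerator `Q` serves both in the fraction field and pointwise on `T`. Hence a formal
  -- relation among the `r i` becomes a relation among the `f i` on `T`; the coordinates `g` may
  -- themselves be dependent there.
  have key : ∀ P : MvPolynomial (Fin m) ℂ, ∃ (M : ℕ) (Q : MvPolynomial τ ℂ),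
      MvPolynomial.aeval r P * φ H ^ M = φ Q ∧
      ∀ x ∈ T, MvPolynomial.eval (fun i => f i x) P * MvPolynomial.eval (g x) H ^ M =
        MvPolynomial.eval (g x) Q := by
    intro P
    induction P using MvPolynomial.induction_on with
    | C a => exact ⟨0, MvPolynomial.C a, by simp [← MvPolynomial.algebraMap_eq], by simp⟩
    | add p q hp hq =>
      obtain ⟨M₁, Q₁, h₁, h₁'⟩ := hp
      obtain ⟨M₂, Q₂, h₂, h₂'⟩ := hq
      refine ⟨M₁ + M₂, Q₁ * H ^ M₂ + Q₂ * H ^ M₁, ?_, fun x hx => ?_⟩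
      · simp only [map_add, map_mul, map_pow, ← h₁, ← h₂]; ring
      · simp only [map_add, map_mul, map_pow, ← h₁' x hx, ← h₂' x hx]; ring
    | mul_X p i hp =>
      obtain ⟨M₁, Q₁, h₁, h₁'⟩ := hp
      refine ⟨M₁ + N i, Q₁ * G i, ?_, fun x hx => ?_⟩
      · have hc := div_mul_cancel₀ (φ (G i)) (pow_ne_zero (N i) hφH)
        simp only [map_mul, MvPolynomial.aeval_X, ← h₁, pow_add]
        linear_combination (MvPolynomial.aeval r p * φ H ^ M₁) * hc
      · simp only [map_mul, MvPolynomial.eval_X, ← h₁' x hx, ← hG i x hx]; ring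
  have hr : AlgebraicIndependent ℂ r := by
    rw [algebraicIndependent_iff]
    intro P hP
    obtain ⟨M, Q, h, h'⟩ := key P
    have hQ : Q = 0 := hφ (by rw [← h, hP]; simp)
    refine hf P fun x hx => ?_
    have := h' x hx
    rw [hQ, map_zero] at this
    exact (mul_eq_zero.mp this).resolve_right (pow_ne_zero _ (hH x hx))
  have := hr.lift_cardinalMk_le_trdeg
  rw [trdeg_fractionRing_mvPolynomial] at this
  simpa using this

section Chain

variable {X : Type*} [TopologicalSpace X] (A : Subalgebra ℂ (X → ℂ)) (U : Set X)

/-- Nonempty open subsets of an irreducible set meet, so functions with open nonvanishing loci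
behave there as in an integral domain. -/
theorem mul_ne_zero_on_irreducible {A : Subalgebra ℂ (X → ℂ)} {U : Set X}
    (hopen : ∀ f ∈ A, IsOpen {x | x ∈ U ∧ f x ≠ 0})
    {Z : Set X} (hZ : IsPreirreducible Z) {f g : X → ℂ} (hf : f ∈ A) (hg : g ∈ A)
    (hfg : ∀ x ∈ Z ∩ U, f x * g x = 0) (hfZ : ∃ x ∈ Z ∩ U, f x ≠ 0) :
    ∀ x ∈ Z ∩ U, g x = 0 := by
  by_contra! h
  obtain ⟨y, hy, hgy⟩ := h
  obtain ⟨x, hx, hfx⟩ := hfZ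
  obtain ⟨z, hzZ, ⟨hzU, hz⟩, -, hz'⟩ := hZ _ _ (hopen f hf) (hopen g hg)
    ⟨x, hx.1, hx.2, hfx⟩ ⟨y, hy.1, hy.2, hgy⟩
  exact mul_ne_zero hz hz' (hfg z ⟨hzZ, hzU⟩)

/-- A chain of `m + 1` irreducible closed sets yields `m` algebraically independent functions. -/
theorem exists_algIndepOn_of_chain
    (hopen : ∀ f ∈ A, IsOpen {x | x ∈ U ∧ f x ≠ 0})
    (hsep : ∀ Z : Set X, IsClosed Z → ∀ x ∈ U, x ∉ Z → ∃ f ∈ A, (∀ z ∈ Z ∩ U, f z = 0) ∧ f x ≠ 0)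
    (m : ℕ) (Z : Fin (m + 1) → TopologicalSpace.IrreducibleCloseds X) (hZ : StrictMono Z)
    (h0 : ((Z 0 : Set X) ∩ U).Nonempty) :
    ∃ f : Fin m → X → ℂ, (∀ i, f i ∈ A) ∧ AlgIndepOn f ((Z (Fin.last m) : Set X) ∩ U) := by
  have hU : IsOpen U := by simpa using hopen 1 A.one_mem
  induction m with
  | zero =>
    refine ⟨Fin.elim0, fun i => i.elim0, fun P hP => ?_⟩
    obtain ⟨x, hx⟩ := h0
    have h := hP x hx
    rw [MvPolynomial.eq_C_of_isEmpty P] at h ⊢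
    simpa using h
  | succ m ih =>
    obtain ⟨f, hfA, hf⟩ := ih (fun i => Z i.castSucc) (hZ.comp (Fin.strictMono_castSucc)) h0
    have hlt : Z (Fin.last m).castSucc < Z (Fin.last (m + 1)) := hZ (Fin.castSucc_lt_last _)
    set Z₁ := Z (Fin.last m).castSucc
    set Z₂ := Z (Fin.last (m + 1))
    have hsub : (Z₁ : Set X) ⊆ Z₂ := hlt.le
    have hne : ((Z₂ : Set X) ∩ U).Nonempty := by
      obtain ⟨x, hx⟩ := h0
      exact ⟨x, (hZ.monotone (Fin.zero_le _) : Z 0 ≤ Z₂) hx.1, hx.2⟩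
    obtain ⟨y, hy, hyU, hy₁⟩ : ∃ y ∈ (Z₂ : Set X), y ∈ U ∧ y ∉ (Z₁ : Set X) := by
      obtain ⟨w, hw, hw'⟩ : ∃ w ∈ (Z₂ : Set X), w ∉ (Z₁ : Set X) :=
        Set.exists_of_ssubset (SetLike.coe_ssubset_coe.mpr hlt)
      obtain ⟨y, hy, hyU, hy₁⟩ := Z₂.isIrreducible.2 U (Z₁ : Set X)ᶜ hU
        Z₁.isClosed.isOpen_compl hne ⟨w, hw, hw'⟩
      exact ⟨y, hy, hyU, hy₁⟩
    -- The new function vanishes on the smaller set `Z₁`, where the old functions are independent,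
    -- but not on `Z₂`.
    obtain ⟨g, hgA, hg0, hgy⟩ := hsep Z₁ Z₁.isClosed y hyU hy₁
    have hmem : ∀ i, (Fin.cons g f : Fin (m + 1) → X → ℂ) i ∈ A :=
      fun i => Fin.cases hgA hfA i
    refine ⟨Fin.cons g f, hmem, ?_⟩
    have hcons : ∀ x, (fun i => (Fin.cons g f : Fin (m + 1) → X → ℂ) i x) =
        Fin.cons (g x) (fun i => f i x) := fun x => by
      funext i; refine Fin.cases ?_ (fun j => ?_) i <;> simp
    have hQA : ∀ Q : Polynomial (MvPolynomial (Fin m) ℂ),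
        (fun x => Polynomial.eval (g x) (Q.map (MvPolynomial.eval fun i => f i x))) ∈ A := by
      intro Q
      have := eval_mem_subalgebra A hmem ((MvPolynomial.finSuccEquiv ℂ m).symm Q)
      simpa only [hcons, MvPolynomial.eval_eq_eval_mv_eval', AlgEquiv.apply_symm_apply] using this
    -- A relation on `Z₂` is a polynomial in `g` over polynomials in `f`. Restricted to `Z₁` it
    -- shows that the constant coefficient is zero; then a factor `g` cancels by irreducibility of
    -- `Z₂`, and the degree drops.
    have key : ∀ (n : ℕ) (Q : Polynomial (MvPolynomial (Fin m) ℂ)), Q.natDegree ≤ n →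
        (∀ x ∈ (Z₂ : Set X) ∩ U,
          Polynomial.eval (g x) (Q.map (MvPolynomial.eval fun i => f i x)) = 0) → Q = 0 := by
      intro n
      induction n with
      | zero =>
        intro Q hQ h
        rw [Polynomial.eq_C_of_natDegree_le_zero hQ] at h ⊢
        rw [hf (Q.coeff 0) fun x hx => by simpa using h x ⟨hsub hx.1, hx.2⟩, map_zero]
      | succ n ihn =>
        intro Q hQ h
        have hc : Q.coeff 0 = 0 := by
          refine hf _ fun x hx => ?_
          have h' := h x ⟨hsub hx.1, hx.2⟩
          rw [hg0 x hx, ← Polynomial.coeff_zero_eq_eval_zero, Polynomial.coeff_map] at h'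
          exact h'
        have hdiv : Q = Q.divX * Polynomial.X := by
          conv_lhs => rw [← Polynomial.divX_mul_X_add Q, hc, map_zero, add_zero]
        have hdeg : Q.divX.natDegree ≤ n := by
          rw [Polynomial.natDegree_divX_eq_natDegree_tsub_one]; omega
        have h0' : Q.divX = 0 := by
          refine ihn _ hdeg (mul_ne_zero_on_irreducible hopen Z₂.isIrreducible.2 hgA (hQA Q.divX)
            (fun x hx => ?_) ⟨y, ⟨hy, hyU⟩, hgy⟩)
          have h' := h x hx
          rw [hdiv] at h'
          simpa [mul_comm] using h'
        rw [hdiv, h0', zero_mul]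
    intro P hP
    have := key _ (MvPolynomial.finSuccEquiv ℂ m P) le_rfl fun x hx => by
      rw [← MvPolynomial.eval_eq_eval_mv_eval', ← hcons]; exact hP x hx
    simpa using this

end Chain

/-- A bound for the dimension of a space with charts, covered by finitely many sets on which
the functions of the charts are rational in at most `d` coordinates. -/
theorem topologicalKrullDim_le_of_cover {X : Type} [TopologicalSpace X] (d : ℕ)
    {κ : Type} [Finite κ] (S : κ → Set X) (hS : ∀ x, ∃ c, x ∈ S c)
    (hchart : ∀ x : X, ∃ (U : Set X) (A : Subalgebra ℂ (X → ℂ)), x ∈ U ∧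
      (∀ f ∈ A, IsOpen {x | x ∈ U ∧ f x ≠ 0}) ∧
      (∀ Z : Set X, IsClosed Z → ∀ x ∈ U, x ∉ Z → ∃ f ∈ A, (∀ z ∈ Z ∩ U, f z = 0) ∧ f x ≠ 0) ∧
      ∀ c, (S c).Nonempty → ∃ (τ : Type) (_ : Fintype τ) (g : X → τ → ℂ) (H : MvPolynomial τ ℂ),
        Fintype.card τ ≤ d ∧ (∀ x ∈ S c ∩ U, MvPolynomial.eval (g x) H ≠ 0) ∧
        ∀ f ∈ A, ∃ (N : ℕ) (G : MvPolynomial τ ℂ), ∀ x ∈ S c ∩ U,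
          f x * MvPolynomial.eval (g x) H ^ N = MvPolynomial.eval (g x) G) :
    topologicalKrullDim X ≤ d := by
  classical
  refine iSup_le fun Z => ?_
  obtain ⟨x₀, hx₀⟩ := (Z 0).isIrreducible.1
  -- A chart around a point of the smallest member meets every member of the chain.
  obtain ⟨U, A, hxU, hopen, hsep, hcell⟩ := hchart x₀
  obtain ⟨f, hfA, hf⟩ := exists_algIndepOn_of_chain A U hopen hsep Z.length Z Z.strictMono
    ⟨x₀, hx₀, hxU⟩
  set W := Z (Fin.last Z.length)
  have hne : ((W : Set X) ∩ U).Nonempty :=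
    ⟨x₀, (Z.strictMono.monotone (Fin.zero_le _) : Z 0 ≤ W) hx₀, hxU⟩
  -- Some cell is dense in `W ∩ U` as far as `A` can see. Otherwise the product over all cells of
  -- functions vanishing on one cell each would be zero on `W ∩ U` with no factor zero there.
  obtain ⟨c, hc⟩ : ∃ c, ∀ h ∈ A, (∀ x ∈ (W : Set X) ∩ (S c ∩ U), h x = 0) →
      ∀ x ∈ (W : Set X) ∩ U, h x = 0 := by
    by_contra! hcon
    choose h hA h0 y hy hhy using hcon
    have := Fintype.ofFinite κ
    have hprod : ∀ s : Finset κ, (∏ c ∈ s, h c) ∈ A ∧ ∃ x ∈ (W : Set X) ∩ U, (∏ c ∈ s, h c) x ≠ 0 := by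
      intro s
      induction s using Finset.induction_on with
      | empty => exact ⟨by simp, hne.some, hne.some_mem, by simp⟩
      | insert c s hcs ih =>
        obtain ⟨ihA, ihx⟩ := ih
        rw [Finset.prod_insert hcs]
        refine ⟨A.mul_mem (hA c) ihA, ?_⟩
        by_contra! hz
        obtain ⟨x, hx, hx'⟩ := ihx
        exact hx' (mul_ne_zero_on_irreducible hopen W.isIrreducible.2 (hA c) ihA
          (fun x hx => by simpa using hz x hx) ⟨y c, hy c, hhy c⟩ x hx)
    obtain ⟨x, hx, hx'⟩ := (hprod Finset.univ).2
    obtain ⟨c, hxc⟩ := hS x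
    refine hx' ?_
    rw [Finset.prod_apply]
    exact Finset.prod_eq_zero (Finset.mem_univ c) (h0 c x ⟨hx.1, hxc, hx.2⟩)
  have hScne : (S c).Nonempty := by
    by_contra hemp
    rw [Set.not_nonempty_iff_eq_empty] at hemp
    exact one_ne_zero (hc 1 A.one_mem (by simp [hemp]) _ hne.some_mem)
  obtain ⟨τ, _, g, H, hcard, hH, hrat⟩ := hcell c hScne
  have hf' : AlgIndepOn f ((W : Set X) ∩ (S c ∩ U)) := fun P hP =>
    hf P (hc _ (eval_mem_subalgebra A hfA P) hP)
  have hle := hf'.le_card g H (fun x hx => hH x hx.2) fun i => by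
    obtain ⟨N, G, h⟩ := hrat (f i) (hfA i)
    exact ⟨N, G, fun x hx => h x hx.2⟩
  exact_mod_cast hle.trans hcard

/-! ### Lower bounds for Krull dimension by affine families. -/

/-- A lower bound for the dimension of a space that contains the image of `ℂ ^ d` under a map
that is continuous for the Zariski topology and from which the coordinate hyperplanes can be
recovered. -/
theorem le_topologicalKrullDim_of_param {X : Type} [TopologicalSpace X] (d : ℕ)
    (φ : (Fin d → ℂ) → X)
    (hφ : ∀ O : Set X, IsOpen O → ∀ x, φ x ∈ O → ∃ Q : MvPolynomial (Fin d) ℂ,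
      MvPolynomial.eval x Q ≠ 0 ∧ ∀ y, MvPolynomial.eval y Q ≠ 0 → φ y ∈ O)
    (hC : ∀ j, ∃ C : Set X, IsClosed C ∧ ∀ x, φ x ∈ C ↔ x j = 0) :
    (d : WithBot ℕ∞) ≤ topologicalKrullDim X := by
  let L : ℕ → Set (Fin d → ℂ) := fun i => {x | ∀ j : Fin d, i ≤ j → x j = 0}
  have hirr : ∀ i, IsIrreducible (φ '' L i) := by
    refine fun i => ⟨⟨φ 0, 0, fun _ _ => rfl, rfl⟩, ?_⟩
    rintro u v hu hv ⟨_, ⟨x, hx, rfl⟩, hxu⟩ ⟨_, ⟨y, hy, rfl⟩, hyv⟩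
    obtain ⟨P, hPx, hP⟩ := hφ u hu x hxu
    obtain ⟨Q, hQy, hQ⟩ := hφ v hv y hyv
    -- Restriction to the line through `x` and `y` turns `P` and `Q` into nonzero polynomials in one
    -- variable, which have a common nonroot.
    let l : Fin d → Polynomial ℂ := fun j =>
      Polynomial.C (x j) + Polynomial.X * Polynomial.C (y j - x j)
    have hl : ∀ (t : ℂ) (R : MvPolynomial (Fin d) ℂ),
        (MvPolynomial.aeval l R).eval t = MvPolynomial.eval (fun j => x j + t * (y j - x j)) R := by
      intro t R
      induction R using MvPolynomial.induction_on with
      | C a => simp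
      | add p q hp hq => simp [hp, hq]
      | mul_X p i hp => rw [map_mul, Polynomial.eval_mul, hp]; simp [l]
    have hP0 : MvPolynomial.aeval l P ≠ 0 := fun h => hPx (by simpa [h] using (hl 0 P).symm)
    have hQ0 : MvPolynomial.aeval l Q ≠ 0 := fun h => hQy (by simpa [h] using (hl 1 Q).symm)
    obtain ⟨t, ht⟩ : ∃ t, (MvPolynomial.aeval l P * MvPolynomial.aeval l Q).eval t ≠ 0 := by
      by_contra! h
      exact mul_ne_zero hP0 hQ0 (Polynomial.funext fun t => by simpa using h t)
    rw [Polynomial.eval_mul, hl, hl] at ht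
    refine ⟨_, ⟨_, fun j hj => ?_, rfl⟩, hP _ (left_ne_zero_of_mul ht),
      hQ _ (right_ne_zero_of_mul ht)⟩
    simp [hx j hj, hy j hj]
  let Z : Fin (d + 1) → TopologicalSpace.IrreducibleCloseds X := fun i =>
    ⟨closure (φ '' L i), (hirr i).closure, isClosed_closure⟩
  have hZ : StrictMono Z := by
    rw [Fin.strictMono_iff_lt_succ]
    intro i
    obtain ⟨C, hCcl, hC⟩ := hC i
    refine lt_of_le_of_ne (closure_mono (Set.image_mono fun x hx j hj => hx j ?_)) fun h => ?_
    · have : ((i.succ : Fin (d + 1)) : ℕ) = i + 1 := rfl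
      simp only [Fin.val_castSucc, Fin.val_succ] at *; omega
    -- Strictness: the `i`-th unit vector belongs to the larger coordinate subspace, while the
    -- smaller one is mapped into the closed set for coordinate `i`.
    · have h₁ : φ (Pi.single i 1) ∈ (Z i.succ : Set X) := by
        refine subset_closure ⟨_, fun j hj => ?_, rfl⟩
        rw [Pi.single_eq_of_ne]
        rintro rfl
        simp at hj
      rw [← h] at h₁
      have h₂ : closure (φ '' L (i.castSucc : Fin (d+1))) ⊆ C := by
        refine closure_minimal ?_ hCcl
        rintro _ ⟨x, hx, rfl⟩
        exact (hC x).mpr (hx i (by simp))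
      simpa using (hC _).mp (h₂ h₁)
  exact le_iSup_of_le (LTSeries.mk d Z hZ) le_rfl

/-! ### Plücker coordinates, bihomogeneity and the Zariski topology. -/

theorem plucker_basis_change {d e : ℕ} {N : Submodule ℂ (Fin d → ℂ)}
    (v v' : Module.Basis (Fin e) ℂ N) :
    ∃ c : ℂ, c ≠ 0 ∧ ∀ I, plucker v' I = c * plucker v I := by
  refine ⟨(v.toMatrix v').det, ?_, fun I => ?_⟩
  · intro h
    have := congrArg Matrix.det (v.toMatrix_mul_toMatrix_flip v')
    rw [Matrix.det_mul, h, zero_mul, Matrix.det_one] at this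
    exact zero_ne_one this
  · rw [plucker, plucker, mul_comm, ← Matrix.det_mul]
    congr 1
    ext i j
    have h := congrArg (fun x : N => (x : Fin d → ℂ) (I i)) (v.sum_toMatrix_smul_self v' j)
    simp only [Submodule.coe_sum, Submodule.coe_smul, Finset.sum_apply, Pi.smul_apply,
      smul_eq_mul] at h
    simp only [Matrix.of_apply, Matrix.mul_apply, ← h]
    exact Finset.sum_congr rfl fun k _ => mul_comm _ _

theorem eval_weight_mul {σ : Type} {w : σ → ℕ} {F : MvPolynomial σ ℂ} {p : ℕ}
    (hF : MvPolynomial.IsWeightedHomogeneous w F p) (c : ℂ) (x : σ → ℂ) :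
    MvPolynomial.eval (fun i => c ^ w i * x i) F = c ^ p * MvPolynomial.eval x F := by
  rw [MvPolynomial.eval_eq, MvPolynomial.eval_eq, Finset.mul_sum]
  refine Finset.sum_congr rfl fun m hm => ?_
  have hw := hF (MvPolynomial.mem_support_iff.mp hm)
  rw [Finsupp.weight_apply, Finsupp.sum] at hw
  have : ∏ i ∈ m.support, (c ^ w i) ^ m i = c ^ p := by
    rw [← hw, ← Finset.prod_pow_eq_pow_sum]
    exact Finset.prod_congr rfl fun i _ => by rw [← pow_mul, smul_eq_mul, mul_comm]
  simp only [mul_pow, Finset.prod_mul_distrib, this]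
  ring

theorem IsBihomogeneous.eval_mul {σ τ : Type} {F : MvPolynomial (σ ⊕ τ) ℂ} {p q : ℕ}
    (hF : IsBihomogeneous F p q) (c d : ℂ) (x : σ → ℂ) (y : τ → ℂ) :
    MvPolynomial.eval (Sum.elim (fun i => c * x i) fun j => d * y j) F =
      c ^ p * d ^ q * MvPolynomial.eval (Sum.elim x y) F := by
  rw [mul_assoc, ← eval_weight_mul hF.2, ← eval_weight_mul hF.1]
  congr 2
  funext i
  cases i <;> simp

theorem IsBihomogeneous.mul {σ τ : Type} {F G : MvPolynomial (σ ⊕ τ) ℂ} {p q p' q' : ℕ}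
    (hF : IsBihomogeneous F p q) (hG : IsBihomogeneous G p' q') :
    IsBihomogeneous (F * G) (p + p') (q + q') :=
  ⟨hF.1.mul hG.1, hF.2.mul hG.2⟩

theorem IsBihomogeneous.add {σ τ : Type} {F G : MvPolynomial (σ ⊕ τ) ℂ} {p q : ℕ}
    (hF : IsBihomogeneous F p q) (hG : IsBihomogeneous G p q) : IsBihomogeneous (F + G) p q :=
  ⟨hF.1.add hG.1, hF.2.add hG.2⟩

theorem IsBihomogeneous.pow {σ τ : Type} {F : MvPolynomial (σ ⊕ τ) ℂ} {p q : ℕ}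
    (hF : IsBihomogeneous F p q) (n : ℕ) : IsBihomogeneous (F ^ n) (n * p) (n * q) :=
  ⟨hF.1.pow n, hF.2.pow n⟩

theorem isBihomogeneous_C {σ τ : Type} (a : ℂ) :
    IsBihomogeneous (MvPolynomial.C a : MvPolynomial (σ ⊕ τ) ℂ) 0 0 :=
  ⟨MvPolynomial.isWeightedHomogeneous_C _ _, MvPolynomial.isWeightedHomogeneous_C _ _⟩

theorem isBihomogeneous_X_inl {σ τ : Type} (i : σ) :
    IsBihomogeneous (MvPolynomial.X (Sum.inl i) : MvPolynomial (σ ⊕ τ) ℂ) 1 0 :=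
  ⟨MvPolynomial.isWeightedHomogeneous_X _ _ _, MvPolynomial.isWeightedHomogeneous_X _ _ _⟩

theorem isBihomogeneous_X_inr {σ τ : Type} (j : τ) :
    IsBihomogeneous (MvPolynomial.X (Sum.inr j) : MvPolynomial (σ ⊕ τ) ℂ) 0 1 :=
  ⟨MvPolynomial.isWeightedHomogeneous_X _ _ _, MvPolynomial.isWeightedHomogeneous_X _ _ _⟩

/-- Bihomogenization of a polynomial with respect to one variable of each group. -/
theorem exists_bihomogenization {σ τ : Type} (i₀ : σ) (j₀ : τ) (F : MvPolynomial (σ ⊕ τ) ℂ) :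
    ∃ (D : ℕ) (G : MvPolynomial (σ ⊕ τ) ℂ), IsBihomogeneous G D D ∧
      ∀ (x : σ → ℂ) (y : τ → ℂ), x i₀ ≠ 0 → y j₀ ≠ 0 → MvPolynomial.eval (Sum.elim x y) G =
        (x i₀ * y j₀) ^ D *
          MvPolynomial.eval (Sum.elim (fun i => x i / x i₀) fun j => y j / y j₀) F := by
  have hXX := (isBihomogeneous_X_inl (τ := τ) i₀).mul (isBihomogeneous_X_inr (σ := σ) j₀)
  have hpow := fun D => by simpa using hXX.pow D
  induction F using MvPolynomial.induction_on with
  | C a => exact ⟨0, MvPolynomial.C a, isBihomogeneous_C a, by simp⟩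
  | add F₁ F₂ h₁ h₂ =>
    obtain ⟨D₁, G₁, hG₁, h₁⟩ := h₁
    obtain ⟨D₂, G₂, hG₂, h₂⟩ := h₂
    refine ⟨D₁ + D₂, _, (hG₁.mul (hpow D₂)).add
      (by simpa only [add_comm] using hG₂.mul (hpow D₁)), fun x y hx hy => ?_⟩
    simp only [map_add, map_mul, map_pow, MvPolynomial.eval_X, Sum.elim_inl, Sum.elim_inr,
      h₁ x y hx hy, h₂ x y hx hy]
    ring
  | mul_X F i h =>
    obtain ⟨D, G, hG, h⟩ := h
    cases i with
    | inl i =>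
      refine ⟨D + 1, _, hG.mul ((isBihomogeneous_X_inl i).mul
        (isBihomogeneous_X_inr j₀)), fun x y hx hy => ?_⟩
      simp only [map_mul, MvPolynomial.eval_X, Sum.elim_inl, Sum.elim_inr, h x y hx hy]
      field_simp
      ring
    | inr j =>
      refine ⟨D + 1, _, hG.mul ((isBihomogeneous_X_inl i₀).mul
        (isBihomogeneous_X_inr j)), fun x y hx hy => ?_⟩
      simp only [map_mul, MvPolynomial.eval_X, Sum.elim_inl, Sum.elim_inr, h x y hx hy]
      field_simp
      ring

section Topology

variable {d₁ d₂ e₁ e₂ : ℕ}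

theorem mem_nonvanishingLocus_iff {F : MvPolynomial ((Fin e₁ ↪o Fin d₁) ⊕ (Fin e₂ ↪o Fin d₂)) ℂ}
    {p q : ℕ} (hF : IsBihomogeneous F p q) (N : GrassmannianPair d₁ d₂ e₁ e₂)
    (v : Module.Basis (Fin e₁) ℂ N.N₁) (w : Module.Basis (Fin e₂) ℂ N.N₂) :
    N ∈ nonvanishingLocus F ↔ MvPolynomial.eval (Sum.elim (plucker v) (plucker w)) F ≠ 0 := by
  refine ⟨?_, fun h => ⟨v, w, h⟩⟩
  rintro ⟨v', w', h⟩
  obtain ⟨c, hc, hv⟩ := plucker_basis_change v v'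
  obtain ⟨d, hd, hw⟩ := plucker_basis_change w w'
  rw [show plucker v' = fun I => c * plucker v I from funext hv,
    show plucker w' = fun I => d * plucker w I from funext hw, hF.eval_mul] at h
  exact right_ne_zero_of_mul h

theorem isOpen_nonvanishingLocus
    {F : MvPolynomial ((Fin e₁ ↪o Fin d₁) ⊕ (Fin e₂ ↪o Fin d₂)) ℂ}
    {p q : ℕ} (hF : IsBihomogeneous F p q) :
    IsOpen (nonvanishingLocus F : Set (GrassmannianPair d₁ d₂ e₁ e₂)) :=
  TopologicalSpace.isOpen_generateFrom_of_mem ⟨p, q, F, hF, rfl⟩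

theorem GrassmannianPair.exists_basis (N : GrassmannianPair d₁ d₂ e₁ e₂) :
    Nonempty (Module.Basis (Fin e₁) ℂ N.N₁) ∧ Nonempty (Module.Basis (Fin e₂) ℂ N.N₂) :=
  ⟨⟨Module.finBasisOfFinrankEq ℂ _ N.finrank_N₁⟩, ⟨Module.finBasisOfFinrankEq ℂ _ N.finrank_N₂⟩⟩

/-- The generating sets form a basis: a product of bihomogeneous polynomials cuts out the
intersection of the loci. -/
theorem exists_nonvanishingLocus_subset {O : Set (GrassmannianPair d₁ d₂ e₁ e₂)} (hO : IsOpen O)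
    {N : GrassmannianPair d₁ d₂ e₁ e₂} (hN : N ∈ O) :
    ∃ (p q : ℕ) (F : MvPolynomial ((Fin e₁ ↪o Fin d₁) ⊕ (Fin e₂ ↪o Fin d₂)) ℂ),
      IsBihomogeneous F p q ∧ N ∈ nonvanishingLocus F ∧
        (nonvanishingLocus F : Set (GrassmannianPair d₁ d₂ e₁ e₂)) ⊆ O := by
  induction hO with
  | basic U hU =>
    obtain ⟨p, q, F, hF, rfl⟩ := hU
    exact ⟨p, q, F, hF, hN, subset_rfl⟩
  | univ =>
    obtain ⟨⟨v⟩, ⟨w⟩⟩ := N.exists_basis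
    exact ⟨0, 0, MvPolynomial.C 1, isBihomogeneous_C 1, ⟨v, w, by simp⟩, Set.subset_univ _⟩
  | inter s t _ _ hs ht =>
    obtain ⟨p, q, F, hF, hNF, hsub⟩ := hs hN.1
    obtain ⟨p', q', F', hF', hNF', hsub'⟩ := ht hN.2
    have hloc : ∀ M : GrassmannianPair d₁ d₂ e₁ e₂, M ∈ nonvanishingLocus (F * F') ↔
        M ∈ nonvanishingLocus F ∧ M ∈ nonvanishingLocus F' := by
      intro M
      obtain ⟨⟨v⟩, ⟨w⟩⟩ := M.exists_basis
      rw [mem_nonvanishingLocus_iff (hF.mul hF') M v w, mem_nonvanishingLocus_iff hF M v w,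
        mem_nonvanishingLocus_iff hF' M v w, map_mul, mul_ne_zero_iff]
    exact ⟨_, _, _, hF.mul hF', (hloc N).mpr ⟨hNF, hNF'⟩,
      fun M hM => ⟨hsub ((hloc M).mp hM).1, hsub' ((hloc M).mp hM).2⟩⟩
  | sUnion S _ ih =>
    obtain ⟨s, hs, hNs⟩ := hN
    obtain ⟨p, q, F, hF, hNF, hsub⟩ := ih s hs hNs
    exact ⟨p, q, F, hF, hNF, hsub.trans (Set.subset_sUnion_of_mem hs)⟩

/-- A bound for the dimension of a subspace that is covered by finitely many sets on which the
Plücker coordinates are polynomials in at most `d` functions. -/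
theorem topologicalKrullDim_le_of_cells (Y : Set (GrassmannianPair d₁ d₂ e₁ e₂)) (d : ℕ)
    (v : ∀ N : GrassmannianPair d₁ d₂ e₁ e₂, Module.Basis (Fin e₁) ℂ N.N₁)
    (w : ∀ N : GrassmannianPair d₁ d₂ e₁ e₂, Module.Basis (Fin e₂) ℂ N.N₂)
    (hv : ∀ N, ∃ I, plucker (v N) I ≠ 0) (hw : ∀ N, ∃ J, plucker (w N) J ≠ 0)
    {κ : Type} [Finite κ] (S : κ → Set Y) (hS : ∀ x, ∃ c, x ∈ S c)
    (hcell : ∀ c, (S c).Nonempty → ∃ (τ : Type) (_ : Fintype τ) (g : Y → τ → ℂ),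
      Fintype.card τ ≤ d ∧
      (∀ I, ∃ P : MvPolynomial τ ℂ, ∀ x ∈ S c, plucker (v x) I = MvPolynomial.eval (g x) P) ∧
      (∀ J, ∃ P : MvPolynomial τ ℂ, ∀ x ∈ S c, plucker (w x) J = MvPolynomial.eval (g x) P)) :
    topologicalKrullDim Y ≤ d := by
  refine topologicalKrullDim_le_of_cover d S hS fun x₀ => ?_
  obtain ⟨I, hI⟩ := hv x₀
  obtain ⟨J, hJ⟩ := hw x₀
  let L : (Fin e₁ ↪o Fin d₁) ⊕ (Fin e₂ ↪o Fin d₂) → Y → ℂ := fun i x =>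
    Sum.elim (fun I' => plucker (v x) I' / plucker (v x) I)
      (fun J' => plucker (w x) J' / plucker (w x) J) i
  let Φ : MvPolynomial ((Fin e₁ ↪o Fin d₁) ⊕ (Fin e₂ ↪o Fin d₂)) ℂ →ₐ[ℂ] (Y → ℂ) :=
    MvPolynomial.aeval L
  have hΦ : ∀ F x, Φ F x = MvPolynomial.eval (Sum.elim
      (fun I' => plucker (v x) I' / plucker (v x) I)
      (fun J' => plucker (w x) J' / plucker (w x) J)) F := by
    intro F x
    induction F using MvPolynomial.induction_on with
    | C a => simp [Φ]
    | add p q hp hq => simp [hp, hq]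
    | mul_X p i hp => rw [map_mul, Pi.mul_apply, hp]; simp [Φ, L]
  let U : Set Y := {x | plucker (v x) I ≠ 0 ∧ plucker (w x) J ≠ 0}
  refine ⟨U, Φ.range, ⟨hI, hJ⟩, ?_, ?_, ?_⟩
  · rintro _ ⟨F, rfl⟩
    obtain ⟨D, G, hG, h⟩ := exists_bihomogenization I J F
    -- The factor `X_I X_J` restricts the locus of the bihomogenization to the chart `U`.
    have hXX := (isBihomogeneous_X_inl (τ := Fin e₂ ↪o Fin d₂) I).mul
      (isBihomogeneous_X_inr (σ := Fin e₁ ↪o Fin d₁) J)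
    have := (isOpen_nonvanishingLocus (hXX.mul hG)).preimage (continuous_subtype_val (p := (· ∈ Y)))
    convert this using 1
    ext x
    rw [Set.mem_preimage, mem_nonvanishingLocus_iff (hXX.mul hG) x.1 (v x) (w x)]
    simp only [map_mul, MvPolynomial.eval_X, Sum.elim_inl, Sum.elim_inr, mul_ne_zero_iff]
    refine and_congr_right fun hx => ?_
    change Φ F x ≠ 0 ↔ _
    rw [h _ _ hx.1 hx.2, hΦ]
    simp [hx.1, hx.2]
  · intro Z hZ x hxU hxZ
    obtain ⟨O, hO, hOZ⟩ := isOpen_induced_iff.mp hZ.isOpen_compl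
    have hxO : (x : GrassmannianPair d₁ d₂ e₁ e₂) ∈ O := by
      change x ∈ Subtype.val ⁻¹' O
      rw [hOZ]; exact hxZ
    obtain ⟨p, q, F, hF, hxF, hsub⟩ := exists_nonvanishingLocus_subset hO hxO
    have hF' : ∀ y ∈ U, (Φ F y ≠ 0 ↔ (y : GrassmannianPair d₁ d₂ e₁ e₂) ∈ nonvanishingLocus F) := by
      intro y hy
      rw [mem_nonvanishingLocus_iff hF y.1 (v y) (w y), hΦ]
      simp only [div_eq_inv_mul]
      rw [hF.eval_mul]
      simp [hy.1, hy.2]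
    refine ⟨Φ F, ⟨F, rfl⟩, fun z hz => ?_, (hF' x hxU).mpr hxF⟩
    by_contra hne
    have : z ∈ Subtype.val ⁻¹' O := hsub ((hF' z hz.2).mp hne)
    rw [hOZ] at this
    exact this hz.1
  · intro c hc
    obtain ⟨τ, _, g, hcard, hP, hQ⟩ := hcell c hc
    choose P hP using hP
    choose Q hQ using hQ
    -- The common denominator is the product of the two Plücker coordinates that define the chart.
    refine ⟨τ, inferInstance, g, P I * Q J, hcard, fun x hx => ?_, ?_⟩
    · rw [map_mul, ← hP I x hx.1, ← hQ J x hx.1]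
      exact mul_ne_zero hx.2.1 hx.2.2
    · rintro _ ⟨F, rfl⟩
      obtain ⟨D, G, -, h⟩ := exists_bihomogenization I J F
      refine ⟨D, MvPolynomial.bind₁ (Sum.elim P Q) G, fun x hx => ?_⟩
      have hx' := h _ _ hx.2.1 hx.2.2
      rw [← hΦ] at hx'
      rw [map_mul, ← hP I x hx.1, ← hQ J x hx.1, mul_comm]
      refine hx'.symm.trans ?_
      rw [← MvPolynomial.coe_aeval_eq_eval, ← MvPolynomial.coe_aeval_eq_eval, RingHom.coe_coe,
        RingHom.coe_coe, MvPolynomial.aeval_bind₁]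
      congr 2
      funext i
      cases i with
      | inl i => exact hP i x hx.1
      | inr j => exact hQ j x hx.1

end Topology

/-! ### Reduced echelon bases. -/

/-- The data of a reduced echelon basis with pivot positions `S`. -/
structure IsReducedEchelon {n e : ℕ} (N : Submodule ℂ (Fin n → ℂ)) (S : Fin e ↪o Fin n)
    (v : Module.Basis (Fin e) ℂ N) : Prop where
  pivot : ∀ i j, (v i : Fin n → ℂ) (S j) = if i = j then 1 else 0
  lower : ∀ i k, k < S i → (v i : Fin n → ℂ) k = 0
  mem_range : ∀ u ∈ N, ∀ k, u k ≠ 0 → (∀ j < k, u j = 0) → k ∈ Set.range S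

theorem exists_leading {n : ℕ} {u : Fin n → ℂ} (hu : u ≠ 0) :
    ∃ k, u k ≠ 0 ∧ ∀ j < k, u j = 0 := by
  obtain ⟨k, hk⟩ := Function.ne_iff.mp hu
  obtain ⟨m, hm, hmin⟩ := WellFounded.has_min (wellFounded_lt (α := Fin n)) {k | u k ≠ 0} ⟨k, hk⟩
  exact ⟨m, hm, fun j hj => by_contra fun h => hmin j h hj⟩

/-- The pivots are the positions of the leading (first nonzero) entries of vectors of `N`. A vector
of `N` that vanishes at all of them is zero, so the projection to these positions is an isomorphism,
and the basis is the preimage of the standard one. -/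
theorem exists_isReducedEchelon {n e : ℕ} (N : Submodule ℂ (Fin n → ℂ))
    (hN : Module.finrank ℂ N = e) :
    ∃ (S : Fin e ↪o Fin n) (v : Module.Basis (Fin e) ℂ N), IsReducedEchelon N S v := by
  classical
  let P : Finset (Fin n) := Finset.univ.filter fun k => ∃ u ∈ N, u k ≠ 0 ∧ ∀ j < k, u j = 0
  have hP : ∀ k, k ∈ P ↔ ∃ u ∈ N, u k ≠ 0 ∧ ∀ j < k, u j = 0 := by simp [P]
  have hzero : ∀ u ∈ N, (∀ k ∈ P, u k = 0) → u = 0 := by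
    intro u hu h
    by_contra hne
    obtain ⟨k, hk, hk'⟩ := exists_leading hne
    exact hk (h k ((hP k).mpr ⟨u, hu, hk, hk'⟩))
  have hcard : P.card = e := by
    -- Vectors with distinct leading positions are independent; conversely, projection to the
    -- leading positions is injective on `N`.
    apply le_antisymm
    · have hch : ∀ k : P, ∃ u : N, (u : Fin n → ℂ) k ≠ 0 ∧ ∀ j < (k : Fin n), (u : Fin n → ℂ) j = 0 :=
        fun k => by
          obtain ⟨u, hu, h⟩ := (hP k).mp k.2
          exact ⟨⟨u, hu⟩, h⟩
      choose u hu hu0 using hch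
      have hli : LinearIndependent ℂ u := by
        rw [Fintype.linearIndependent_iff]
        intro c hc k
        induction k using WellFoundedLT.induction with
        | ind k ih =>
          have h := congrArg (fun x : N => (x : Fin n → ℂ) k) hc
          simp only [Submodule.coe_sum, Submodule.coe_smul, Finset.sum_apply, Pi.smul_apply,
            smul_eq_mul, ZeroMemClass.coe_zero, Pi.zero_apply] at h
          rw [Finset.sum_eq_single k] at h
          · exact (mul_eq_zero.mp h).resolve_right (hu k)
          · intro l _ hl
            rcases lt_or_gt_of_ne hl with hlt | hlt
            · rw [ih l hlt, zero_mul]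
            · rw [hu0 l k hlt, mul_zero]
          · simp
      simpa [hN] using hli.fintype_card_le_finrank
    · let π : N →ₗ[ℂ] (P → ℂ) := LinearMap.pi fun k => LinearMap.proj (k : Fin n) ∘ₗ N.subtype
      have hπ : Function.Injective π := by
        rw [← LinearMap.ker_eq_bot, LinearMap.ker_eq_bot']
        intro u hu
        exact Subtype.ext (hzero u u.2 fun k hk => congrFun hu ⟨k, hk⟩)
      simpa [hN] using LinearMap.finrank_le_finrank_of_injective hπ
  let S : Fin e ↪o Fin n := P.orderEmbOfFin hcard
  have hS : Set.range S = P := P.range_orderEmbOfFin hcard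
  let π : N →ₗ[ℂ] (Fin e → ℂ) := LinearMap.pi fun i => LinearMap.proj (S i) ∘ₗ N.subtype
  have hπ : Function.Injective π := by
    rw [← LinearMap.ker_eq_bot, LinearMap.ker_eq_bot']
    intro u hu
    refine Subtype.ext (hzero u u.2 fun k hk => ?_)
    obtain ⟨i, rfl⟩ : k ∈ Set.range S := by rw [hS]; exact hk
    exact congrFun hu i
  let E := LinearEquiv.ofInjectiveOfFinrankEq π hπ (by simp [hN])
  have hE : ∀ u i, E u i = (u : Fin n → ℂ) (S i) := fun u i => rfl
  have hpivot : ∀ i j, (Module.Basis.ofEquivFun E i : Fin n → ℂ) (S j) = if i = j then 1 else 0 := by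
    intro i j
    rw [← hE, Module.Basis.coe_ofEquivFun, LinearEquiv.apply_symm_apply, Pi.single_apply]
    simp only [eq_comm]
  have hmem : ∀ u ∈ N, ∀ k, u k ≠ 0 → (∀ j < k, u j = 0) → k ∈ Set.range S := by
    intro u hu k hk hk'
    rw [hS]
    exact (hP k).mpr ⟨u, hu, hk, hk'⟩
  refine ⟨S, Module.Basis.ofEquivFun E, hpivot, fun i k hk => ?_, hmem⟩
  have hne : (Module.Basis.ofEquivFun E i : Fin n → ℂ) ≠ 0 := fun h => by
    have := hpivot i i
    rw [h, if_pos rfl] at this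
    exact zero_ne_one this
  obtain ⟨m, hm, hm'⟩ := exists_leading hne
  obtain ⟨j, rfl⟩ := hmem _ (Module.Basis.ofEquivFun E i).2 m hm hm'
  rw [hpivot] at hm
  obtain rfl : i = j := by_contra fun h => hm (if_neg h)
  exact hm' k hk

theorem IsReducedEchelon.plucker_pivot {n e : ℕ} {N : Submodule ℂ (Fin n → ℂ)}
    {S : Fin e ↪o Fin n} {v : Module.Basis (Fin e) ℂ N} (h : IsReducedEchelon N S v) :
    plucker v S = 1 := by
  rw [plucker, ← Matrix.det_one (n := Fin e)]
  congr 1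
  ext i j
  simp [h.pivot, Matrix.one_apply, eq_comm]

theorem IsReducedEchelon.apply_eq_sum {n e : ℕ} {N : Submodule ℂ (Fin n → ℂ)}
    {S : Fin e ↪o Fin n} {v : Module.Basis (Fin e) ℂ N} (h : IsReducedEchelon N S v)
    {u : Fin n → ℂ} (hu : u ∈ N) (k : Fin n) :
    u k = ∑ j, u (S j) * (v j : Fin n → ℂ) k := by
  have hk : ∀ k, u k = ∑ j, v.repr ⟨u, hu⟩ j * (v j : Fin n → ℂ) k := fun k => by
    have := congrArg (fun x : N => (x : Fin n → ℂ) k) (v.sum_repr ⟨u, hu⟩).symm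
    simpa only [Submodule.coe_sum, Submodule.coe_smul, Finset.sum_apply, Pi.smul_apply,
      smul_eq_mul] using this
  have hc : ∀ j, u (S j) = v.repr ⟨u, hu⟩ j := fun j => by
    simp [hk (S j), h.pivot]
  simp only [hc]
  exact hk k

/-! ### Upper bound: free entries on a cell of pairs of echelon bases. -/

theorem nilpotentJordan_apply_zero {n : ℕ} (u : Fin n → ℂ) (k : Fin n) (hk : (k : ℕ) = 0) :
    Matrix.toLin' (nilpotentJordan n) u k = 0 := by
  simp [nilpotentJordan, Matrix.mulVec, dotProduct, hk]

theorem nilpotentJordan_apply_succ {n : ℕ} (u : Fin n → ℂ) (k l : Fin n)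
    (hk : (k : ℕ) = l + 1) : Matrix.toLin' (nilpotentJordan n) u k = u l := by
  simp [nilpotentJordan, Matrix.mulVec, dotProduct, hk, Fin.val_inj]

/-- The entries of a pair of reduced echelon bases that satisfy the incidence relations of a
subrepresentation lie in the algebra generated by the entries in free position. -/
theorem mem_subalgebra_of_free_entries {R : Type*} [CommRing R] [Algebra ℂ R]
    (B : Subalgebra ℂ R) {n e₁ e₂ : ℕ} (S₁ : Fin e₁ ↪o Fin n) (S₂ : Fin e₂ ↪o Fin n)
    (a ja : Fin e₁ → Fin n → R) (b : Fin e₂ → Fin n → R)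
    (ha : ∀ i j, a i (S₁ j) = if i = j then 1 else 0) (ha0 : ∀ i k, k < S₁ i → a i k = 0)
    (hb : ∀ i j, b i (S₂ j) = if i = j then 1 else 0) (hb0 : ∀ i k, k < S₂ i → b i k = 0)
    (hja0 : ∀ i (k : Fin n), (k : ℕ) = 0 → ja i k = 0)
    (hja : ∀ i (k l : Fin n), (k : ℕ) = l + 1 → ja i k = a i l)
    (hab : ∀ i k, a i k = ∑ j, a i (S₂ j) * b j k)
    (hjab : ∀ i k, ja i k = ∑ j, ja i (S₂ j) * b j k)
    (hfa : ∀ i j, S₂ j ∉ Set.range S₁ → S₁ i < S₂ j → a i (S₂ j) ∈ B)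
    (hfb : ∀ j k, (∀ i, (S₁ i : ℕ) + 1 ≠ S₂ j) → k ∉ Set.range S₂ → S₂ j < k → b j k ∈ B) :
    (∀ i k, a i k ∈ B) ∧ ∀ j k, b j k ∈ B := by
  classical
  have haS : ∀ i j, a i (S₂ j) ∈ B := by
    intro i j
    by_cases hj : S₂ j ∈ Set.range S₁
    · obtain ⟨i', hi'⟩ := hj
      rw [← hi', ha]
      split_ifs
      exacts [B.one_mem, B.zero_mem]
    · rcases lt_trichotomy (S₁ i) (S₂ j) with h | h | h
      · exact hfa i j hj h
      · exact absurd ⟨i, h⟩ hj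
      · rw [ha0 i _ h]; exact B.zero_mem
  have hcol : ∀ k, (∀ j, b j k ∈ B) → ∀ i, a i k ∈ B := fun k hk i => by
    rw [hab]
    exact B.sum_mem fun j _ => B.mul_mem (haS i j) (hk j)
  -- Induction on the column `k`, and within a column downwards on the row `j`.
  have hball : ∀ k j, b j k ∈ B := by
    intro k
    induction k using WellFoundedLT.induction with
    | ind k ih =>
      intro j
      induction j using WellFoundedGT.induction with
      | ind j ihj =>
        by_cases hk : k ∈ Set.range S₂
        · obtain ⟨j', rfl⟩ := hk
          rw [hb]
          split_ifs
          exacts [B.one_mem, B.zero_mem]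
        rcases lt_trichotomy (S₂ j) k with h | h | h
        · by_cases hi : ∀ i, (S₁ i : ℕ) + 1 ≠ S₂ j
          · exact hfb j k hi hk h
          push Not at hi
          obtain ⟨i, hi⟩ := hi
          have hlt : (S₂ j : ℕ) < k := h
          let l : Fin n := ⟨k - 1, by omega⟩
          have hl : (k : ℕ) = l + 1 := by simp only [l]; omega
          -- If `S₂ j = S₁ i + 1`, then `b j` occurs in the expansion of `ja i` with coefficient 1,
          -- so `b j k` can be solved for. Rows `j' < j` have coefficient 0; rows `j' > j`
          -- contribute only if `S₂ j' ≤ k`, with coefficient from an earlier column.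
          have hsum := hjab i k
          rw [hja i k l hl, ← Finset.add_sum_erase _ _ (Finset.mem_univ j),
            hja i (S₂ j) (S₁ i) hi.symm, ha, if_pos rfl, one_mul, ← sub_eq_iff_eq_add] at hsum
          rw [← hsum]
          refine B.sub_mem (hcol l (ih l (by rw [Fin.lt_def]; omega)) i)
            (B.sum_mem fun j' hj' => ?_)
          rcases lt_or_gt_of_ne (Finset.ne_of_mem_erase hj') with hjj | hjj
          · have hS : (S₂ j' : ℕ) < S₂ j := S₂.strictMono hjj
            have : ja i (S₂ j') = 0 := by
              by_cases h0 : (S₂ j' : ℕ) = 0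
              · exact hja0 i _ h0
              · rw [hja i (S₂ j') ⟨S₂ j' - 1, by omega⟩ (by simp only; omega)]
                exact ha0 i _ (by rw [Fin.lt_def]; simp only; omega)
            rw [this, zero_mul]
            exact B.zero_mem
          · rcases lt_or_ge k (S₂ j') with hkj | hkj
            · rw [hb0 _ _ hkj, mul_zero]
              exact B.zero_mem
            · have hS : (S₂ j : ℕ) < S₂ j' := S₂.strictMono hjj
              have hkj' : (S₂ j' : ℕ) ≤ k := hkj
              refine B.mul_mem ?_ (ihj j' hjj)
              rw [hja i (S₂ j') ⟨S₂ j' - 1, by omega⟩ (by simp only; omega)]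
              exact hcol _ (ih _ (by rw [Fin.lt_def]; simp only; omega)) i
        · exact absurd ⟨j, h⟩ hk
        · rw [hb0 _ _ h]; exact B.zero_mem
  exact ⟨fun i k => hcol k (hball k) i, fun j k => hball k j⟩

/-- The positions of the free entries of a pair of reduced echelon bases. -/
abbrev FreeEntry {n e₁ e₂ : ℕ} (S₁ : Fin e₁ ↪o Fin n) (S₂ : Fin e₂ ↪o Fin n) : Type :=
  {p : Fin e₁ × Fin e₂ // S₂ p.2 ∉ Set.range S₁ ∧ S₁ p.1 < S₂ p.2} ⊕
    {p : Fin e₂ × Fin n //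
      (∀ i, (S₁ i : ℕ) + 1 ≠ S₂ p.1) ∧ p.2 ∉ Set.range S₂ ∧ S₂ p.1 < p.2}

-- The two kinds of entries number at most e₁(e₂ - e₁) and (e₂ - e₁)(n - e₂).
open Classical in
theorem card_freeEntry_le {n e₁ e₂ : ℕ} (S₁ : Fin e₁ ↪o Fin n) (S₂ : Fin e₂ ↪o Fin n)
    (h₁ : ∀ i, S₁ i ∈ Set.range S₂)
    (h₂ : ∀ i (k : Fin n), (k : ℕ) = S₁ i + 1 → k ∈ Set.range S₂) :
    Fintype.card (FreeEntry S₁ S₂) ≤ (e₂ - e₁) * (n - (e₂ - e₁)) := by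
  have he₂ : e₂ ≤ n := by simpa using Fintype.card_le_of_injective _ S₂.injective
  have himg : ∀ {e : ℕ} (S : Fin e ↪o Fin n), (Finset.univ.filter fun k => k ∈ Set.range S).card = e := by
    intro e S
    rw [show (Finset.univ.filter fun k => k ∈ Set.range S) = Finset.univ.map S.toEmbedding by
      ext; simp]
    simp
  choose g hg using h₁
  have hginj : Function.Injective g := fun i i' h => S₁.injective (by rw [← hg, ← hg, h])
  have he : e₁ ≤ e₂ := by simpa using Fintype.card_le_of_injective _ hginj
  have hA : (Finset.univ.filter fun j => S₂ j ∉ Set.range S₁).card ≤ e₂ - e₁ := by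
    have : (Finset.univ.filter fun j => S₂ j ∉ Set.range S₁) ⊆ (Finset.univ.image g)ᶜ := by
      intro j hj
      simp only [Finset.mem_filter, Finset.mem_univ, true_and] at hj
      simp only [Finset.mem_compl, Finset.mem_image, Finset.mem_univ, true_and]
      rintro ⟨i, rfl⟩
      exact hj ⟨i, (hg i).symm⟩
    refine (Finset.card_le_card this).trans ?_
    rw [Finset.card_compl, Finset.card_image_of_injective _ hginj]
    simp
  have hB : (Finset.univ.filter fun j => (∀ i, (S₁ i : ℕ) + 1 ≠ S₂ j) ∧
      ∃ k, k ∉ Set.range S₂ ∧ S₂ j < k).card ≤ e₂ - e₁ := by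
    -- Each `i` must exclude its own row of `w`. The position `S₁ i + 1` may be out of range; so
    -- when no nonpivot lies beyond `S₁ i`, the row with pivot `S₁ i` is taken instead, which has no
    -- free entry.
    have hh : ∀ i, ∃ j, (∃ k, k ∉ Set.range S₂ ∧ S₁ i < k) ∧ (S₂ j : ℕ) = S₁ i + 1 ∨
        (¬ ∃ k, k ∉ Set.range S₂ ∧ S₁ i < k) ∧ S₂ j = S₁ i := by
      intro i
      by_cases hc : ∃ k, k ∉ Set.range S₂ ∧ S₁ i < k
      · obtain ⟨k, hk, hik⟩ := hc
        have hik' : (S₁ i : ℕ) < k := hik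
        obtain ⟨j, hj⟩ := h₂ i ⟨S₁ i + 1, by omega⟩ rfl
        exact ⟨j, Or.inl ⟨⟨k, hk, hik⟩, by rw [hj]⟩⟩
      · exact ⟨g i, Or.inr ⟨hc, hg i⟩⟩
    choose t ht using hh
    -- A clash of the two choices would force the nonpivot beyond `S₁ i` to lie beyond `S₁ i'` or to
    -- equal this pivot.
    have haux : ∀ i i', (∃ k, k ∉ Set.range S₂ ∧ S₁ i < k) →
        (¬ ∃ k, k ∉ Set.range S₂ ∧ S₁ i' < k) → (S₁ i' : ℕ) = S₁ i + 1 → False := by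
      rintro i i' ⟨k, hk, hik⟩ hc h
      have hik' : (S₁ i : ℕ) < k := hik
      refine hc ⟨k, hk, lt_of_le_of_ne (by rw [Fin.le_def]; omega) ?_⟩
      rintro rfl
      exact hk ⟨g i', hg i'⟩
    have htinj : Function.Injective t := by
      intro i i' h
      have hi := ht i
      rw [h] at hi
      rcases hi with ⟨hc, hi⟩ | ⟨hc, hi⟩ <;> rcases ht i' with ⟨hc', hi'⟩ | ⟨hc', hi'⟩
      · exact S₁.injective (Fin.ext (by omega))
      · exact (haux i i' hc hc' (by rw [← hi', hi])).elim
      · exact (haux i' i hc' hc (by rw [← hi, hi'])).elim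
      · exact S₁.injective (hi.symm.trans hi')
    have : (Finset.univ.filter fun j => (∀ i, (S₁ i : ℕ) + 1 ≠ S₂ j) ∧
        ∃ k, k ∉ Set.range S₂ ∧ S₂ j < k) ⊆ (Finset.univ.image t)ᶜ := by
      intro j hj
      simp only [Finset.mem_filter, Finset.mem_univ, true_and] at hj
      simp only [Finset.mem_compl, Finset.mem_image, Finset.mem_univ, true_and]
      rintro ⟨i, rfl⟩
      rcases ht i with ⟨_, hi⟩ | ⟨hc, hi⟩
      · exact hj.1 i hi.symm
      · rw [hi] at hj
        exact hc hj.2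
    refine (Finset.card_le_card this).trans ?_
    rw [Finset.card_compl, Finset.card_image_of_injective _ htinj]
    simp
  have hC : (Finset.univ.filter fun k => k ∉ Set.range S₂).card ≤ n - e₂ := by
    have := Finset.card_filter_add_card_filter_not (s := (Finset.univ : Finset (Fin n)))
      (fun k => k ∈ Set.range S₂)
    rw [himg S₂] at this
    simp only [Finset.card_univ, Fintype.card_fin] at this
    omega
  rw [Fintype.card_sum, Fintype.card_subtype, Fintype.card_subtype]
  have hsum₁ : (Finset.univ.filter fun p : Fin e₁ × Fin e₂ =>
      S₂ p.2 ∉ Set.range S₁ ∧ S₁ p.1 < S₂ p.2).card ≤ e₁ * (e₂ - e₁) := by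
    have : (Finset.univ.filter fun p : Fin e₁ × Fin e₂ =>
        S₂ p.2 ∉ Set.range S₁ ∧ S₁ p.1 < S₂ p.2) ⊆
        Finset.univ ×ˢ (Finset.univ.filter fun j => S₂ j ∉ Set.range S₁) := by
      intro p hp
      simp only [Finset.mem_filter, Finset.mem_univ, true_and, Finset.mem_product] at hp ⊢
      exact hp.1
    refine (Finset.card_le_card this).trans ?_
    rw [Finset.card_product]
    simpa using Nat.mul_le_mul_left e₁ hA
  have hsum₂ : (Finset.univ.filter fun p : Fin e₂ × Fin n =>
      (∀ i, (S₁ i : ℕ) + 1 ≠ S₂ p.1) ∧ p.2 ∉ Set.range S₂ ∧ S₂ p.1 < p.2).card ≤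
      (e₂ - e₁) * (n - e₂) := by
    have : (Finset.univ.filter fun p : Fin e₂ × Fin n =>
        (∀ i, (S₁ i : ℕ) + 1 ≠ S₂ p.1) ∧ p.2 ∉ Set.range S₂ ∧ S₂ p.1 < p.2) ⊆
        (Finset.univ.filter fun j => (∀ i, (S₁ i : ℕ) + 1 ≠ S₂ j) ∧
          ∃ k, k ∉ Set.range S₂ ∧ S₂ j < k) ×ˢ
        (Finset.univ.filter fun k => k ∉ Set.range S₂) := by
      intro p hp
      simp only [Finset.mem_filter, Finset.mem_univ, true_and, Finset.mem_product] at hp ⊢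
      exact ⟨⟨hp.1, p.2, hp.2⟩, hp.2.1⟩
    refine (Finset.card_le_card this).trans ?_
    rw [Finset.card_product]
    exact Nat.mul_le_mul hB hC
  refine (Nat.add_le_add hsum₁ hsum₂).trans (le_of_eq ?_)
  rw [mul_comm e₁, ← mul_add]
  congr 1
  omega

theorem exists_plucker_eq_eval {X τ : Type} (T : Set X) (g : X → τ → ℂ) {n e : ℕ}
    {N : X → Submodule ℂ (Fin n → ℂ)} (v : ∀ x, Module.Basis (Fin e) ℂ (N x))
    (h : ∀ i k, ∃ P : MvPolynomial τ ℂ, ∀ x ∈ T,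
      (v x i : Fin n → ℂ) k = MvPolynomial.eval (g x) P) (I : Fin e ↪o Fin n) :
    ∃ P : MvPolynomial τ ℂ, ∀ x ∈ T, plucker (v x) I = MvPolynomial.eval (g x) P := by
  choose P hP using h
  refine ⟨(Matrix.of fun i j => P j (I i)).det, fun x hx => ?_⟩
  rw [plucker, RingHom.map_det]
  congr 1
  ext i j
  exact hP j (I i) x hx

theorem topologicalKrullDim_quiverGrassmannian_le (n e₁ e₂ : ℕ) :
    topologicalKrullDim (quiverGrassmannian (regularRep n) e₁ e₂) ≤
      ((e₂ - e₁) * (n - (e₂ - e₁)) : ℕ) := by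
  classical
  choose S₁ v hv using fun N : GrassmannianPair n n e₁ e₂ => exists_isReducedEchelon N.N₁ N.finrank_N₁
  choose S₂ w hw using fun N : GrassmannianPair n n e₁ e₂ => exists_isReducedEchelon N.N₂ N.finrank_N₂
  refine topologicalKrullDim_le_of_cells _ _ v w
    (fun N => ⟨S₁ N, by rw [(hv N).plucker_pivot]; exact one_ne_zero⟩)
    (fun N => ⟨S₂ N, by rw [(hw N).plucker_pivot]; exact one_ne_zero⟩)
    (κ := (Fin e₁ ↪o Fin n) × (Fin e₂ ↪o Fin n))
    (fun c => {x | S₁ x = c.1 ∧ S₂ x = c.2}) (fun x => ⟨(S₁ x, S₂ x), rfl, rfl⟩) ?_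
  rintro ⟨s₁, s₂⟩ ⟨x₀, hx₀⟩
  set T : Set (quiverGrassmannian (regularRep n) e₁ e₂) := {x | S₁ x = s₁ ∧ S₂ x = s₂}
  have hv' : ∀ x ∈ T, IsReducedEchelon x.1.N₁ s₁ (v x) := fun x hx => hx.1 ▸ hv x
  have hw' : ∀ x ∈ T, IsReducedEchelon x.1.N₂ s₂ (w x) := fun x hx => hx.2 ▸ hw x
  let J : (Fin n → ℂ) →ₗ[ℂ] (Fin n → ℂ) := Matrix.toLin' (nilpotentJordan n)
  have hsub : ∀ (x : quiverGrassmannian (regularRep n) e₁ e₂) i,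
      (v x i : Fin n → ℂ) ∈ x.1.N₂ := fun x i => x.2.1 _ (v x i).2
  have hsubJ : ∀ (x : quiverGrassmannian (regularRep n) e₁ e₂) i,
      J (v x i : Fin n → ℂ) ∈ x.1.N₂ := fun x i => x.2.2 _ (v x i).2
  have h₁ : ∀ i, s₁ i ∈ Set.range s₂ := fun i =>
    (hw' x₀ hx₀).mem_range _ (hsub x₀ i) _ (by simp [(hv' x₀ hx₀).pivot]) fun j hj =>
      (hv' x₀ hx₀).lower i j hj
  have h₂ : ∀ i (k : Fin n), (k : ℕ) = s₁ i + 1 → k ∈ Set.range s₂ := fun i k hk => by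
    refine (hw' x₀ hx₀).mem_range _ (hsubJ x₀ i) k ?_ fun j hj => ?_
    · rw [nilpotentJordan_apply_succ _ k (s₁ i) hk, (hv' x₀ hx₀).pivot, if_pos rfl]
      exact one_ne_zero
    · by_cases h0 : (j : ℕ) = 0
      · exact nilpotentJordan_apply_zero _ j h0
      · have hjk : (j : ℕ) < k := hj
        rw [nilpotentJordan_apply_succ _ j ⟨j - 1, by omega⟩ (by simp only; omega)]
        exact (hv' x₀ hx₀).lower i _ (by rw [Fin.lt_def]; simp only; omega)
  let g : quiverGrassmannian (regularRep n) e₁ e₂ → FreeEntry s₁ s₂ → ℂ := fun x =>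
    Sum.elim (fun p => (v x p.1.1 : Fin n → ℂ) (s₂ p.1.2)) fun p => (w x p.1.1 : Fin n → ℂ) p.1.2
  let Φ : MvPolynomial (FreeEntry s₁ s₂) ℂ →ₐ[ℂ] (T → ℂ) := MvPolynomial.aeval fun t x => g x t
  have hΦ : ∀ P (x : T), Φ P x = MvPolynomial.eval (g x) P := by
    intro P x
    induction P using MvPolynomial.induction_on with
    | C a => simp [Φ]
    | add p q hp hq => simp [hp, hq]
    | mul_X p i hp => rw [map_mul, Pi.mul_apply, hp]; simp [Φ]
  have hX : ∀ t, (fun x : T => g x t) ∈ Φ.range := fun t =>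
    ⟨MvPolynomial.X t, by funext x; exact (hΦ _ x).trans (by simp)⟩
  obtain ⟨hA, hB⟩ := mem_subalgebra_of_free_entries Φ.range s₁ s₂
    (fun i k x => (v x.1 i : Fin n → ℂ) k) (fun i k x => J (v x.1 i : Fin n → ℂ) k)
    (fun j k x => (w x.1 j : Fin n → ℂ) k)
    (fun i j => by funext x; rw [(hv' x x.2).pivot]; split_ifs <;> rfl)
    (fun i k hk => by funext x; exact (hv' x x.2).lower i k hk)
    (fun i j => by funext x; rw [(hw' x x.2).pivot]; split_ifs <;> rfl)
    (fun i k hk => by funext x; exact (hw' x x.2).lower i k hk)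
    (fun i k hk => by funext x; exact nilpotentJordan_apply_zero _ k hk)
    (fun i k l hk => by funext x; exact nilpotentJordan_apply_succ _ k l hk)
    (fun i k => by
      funext x; rw [Finset.sum_apply]; exact (hw' x x.2).apply_eq_sum (hsub x i) k)
    (fun i k => by
      funext x; rw [Finset.sum_apply]; exact (hw' x x.2).apply_eq_sum (hsubJ x i) k)
    (fun i j hj hij => hX (Sum.inl ⟨(i, j), hj, hij⟩))
    (fun j k hj hk hjk => hX (Sum.inr ⟨(j, k), hj, hk, hjk⟩))
  refine ⟨FreeEntry s₁ s₂, inferInstance, g, by convert card_freeEntry_le s₁ s₂ h₁ h₂,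
    exists_plucker_eq_eval T g (fun x => v x) fun i k => ?_,
    exists_plucker_eq_eval T g (fun x => w x) fun j k => ?_⟩
  · obtain ⟨P, hP⟩ := hA i k
    exact ⟨P, fun x hx => by rw [← hΦ P ⟨x, hx⟩]; exact (congrFun hP ⟨x, hx⟩).symm⟩
  · obtain ⟨P, hP⟩ := hB j k
    exact ⟨P, fun x hx => by rw [← hΦ P ⟨x, hx⟩]; exact (congrFun hP ⟨x, hx⟩).symm⟩

/-! ### Lower bound: a point for e₁ = e₂, and an affine family for e₁ < e₂. -/

theorem linearIndependent_of_pivot {n e : ℕ} (S : Fin e → Fin n) (v : Fin e → Fin n → ℂ)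
    (h : ∀ i j, v i (S j) = if i = j then 1 else 0) : LinearIndependent ℂ v := by
  rw [Fintype.linearIndependent_iff]
  intro c hc j
  simpa [h] using congrFun hc (S j)

theorem quiverGrassmannian_diagonal_nonempty {n e : ℕ} (h : e ≤ n) :
    (quiverGrassmannian (regularRep n) e e).Nonempty := by
  -- The last `e` standard basis vectors span a `J`-stable subspace.
  let S : Fin e → Fin n := fun j => ⟨n - e + j, by omega⟩
  let v : Fin e → Fin n → ℂ := fun i => Pi.single (S i) 1
  have hv : ∀ i (k : Fin n), v i k = if (k : ℕ) = n - e + i then 1 else 0 := fun i k => by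
    simp only [v, S, Pi.single_apply, Fin.ext_iff]
  have hli : LinearIndependent ℂ v := linearIndependent_of_pivot S v fun i j => by
    rw [hv]
    congr 1
    simp only [S, eq_iff_iff, Fin.ext_iff]
    omega
  have hrank : Module.finrank ℂ (Submodule.span ℂ (Set.range v)) = e := by
    simpa using finrank_span_eq_card hli
  refine ⟨⟨_, _, hrank, hrank⟩, fun x hx => hx, ?_⟩
  suffices hle : Submodule.span ℂ (Set.range v) ≤
      (Submodule.span ℂ (Set.range v)).comap (Matrix.toLin' (nilpotentJordan n)) from
    fun x hx => hle hx
  rw [Submodule.span_le]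
  rintro _ ⟨j, rfl⟩
  rw [SetLike.mem_coe, Submodule.mem_comap]
  by_cases hj : (j : ℕ) + 1 < e
  · suffices hJ : Matrix.toLin' (nilpotentJordan n) (v j) = v ⟨j + 1, hj⟩ by
      rw [hJ]; exact Submodule.subset_span ⟨_, rfl⟩
    funext k
    by_cases hk : (k : ℕ) = 0
    · rw [nilpotentJordan_apply_zero _ _ hk, hv, if_neg (by simp only; omega)]
    · rw [nilpotentJordan_apply_succ _ k ⟨k - 1, by omega⟩ (by simp only; omega)]
      simp only [hv]
      congr 1
      simp only [eq_iff_iff]; omega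
  · suffices hJ : Matrix.toLin' (nilpotentJordan n) (v j) = 0 by
      rw [hJ]; exact Submodule.zero_mem _
    funext k
    by_cases hk : (k : ℕ) = 0
    · rw [nilpotentJordan_apply_zero _ _ hk]; rfl
    · rw [nilpotentJordan_apply_succ _ k ⟨k - 1, by omega⟩ (by simp only; omega), hv,
        if_neg (by simp only; omega)]
      rfl

theorem le_topologicalKrullDim_of_fintype_param {X τ : Type} [TopologicalSpace X] [Fintype τ]
    (φ : (τ → ℂ) → X)
    (hφ : ∀ O : Set X, IsOpen O → ∀ x, φ x ∈ O → ∃ Q : MvPolynomial τ ℂ,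
      MvPolynomial.eval x Q ≠ 0 ∧ ∀ y, MvPolynomial.eval y Q ≠ 0 → φ y ∈ O)
    (hC : ∀ j, ∃ C : Set X, IsClosed C ∧ ∀ x, φ x ∈ C ↔ x j = 0) :
    (Fintype.card τ : WithBot ℕ∞) ≤ topologicalKrullDim X := by
  let ε := Fintype.equivFin τ
  refine le_topologicalKrullDim_of_param _ (fun x => φ (x ∘ ε)) (fun O hO x hx => ?_) fun j => ?_
  · obtain ⟨Q, hQ, h⟩ := hφ O hO _ hx
    exact ⟨MvPolynomial.rename ε Q, by rwa [MvPolynomial.eval_rename], fun y hy =>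
      h _ (by rwa [MvPolynomial.eval_rename] at hy)⟩
  · obtain ⟨C, hC, h⟩ := hC (ε.symm j)
    exact ⟨C, hC, fun x => by rw [h]; simp⟩

section Entries

variable {R : Type*} [CommRing R] (e f : ℕ) (α β : ℕ → ℕ → R)

/-- The columns, from the last pivot column on, of the matrix whose rows span the second
subspace of a family of subrepresentations of dimension vector `(e, e + f)`. -/
def colEntry : ℕ → ℕ → R
  | 0, t => if t + 1 = e + f then 1 else 0
  | k + 1, t =>
    -- Row 0 and the rows beyond `e` carry free parameters, f rows in all; rows 1, …, e are solved
    -- from J N₁ ⊆ N₂ in terms of the preceding column.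
    if t = 0 then β 0 k
    else if t ≤ e then
      colEntry k (t - 1) + ∑ i ∈ Finset.range f,
        α (t - 1) i * (colEntry k (e + i) - if i + 1 < f then β (i + 1) k else 0)
    else β (t - e) k

/-- The entries of the matrix whose rows span the second subspace. -/
def rowEntry (t k : ℕ) : R :=
  -- Index 0 of `colEntry` is column e + f - 1, the last one of the identity block, so that the
  -- recursion has a starting column.
  if k < e + f then (if t = k then 1 else 0) else colEntry e f α β (k + 1 - (e + f)) t

/-- The entries of the matrix whose rows span the first subspace. -/
def subEntry (s k : ℕ) : R :=
  rowEntry e f α β s k + ∑ i ∈ Finset.range f, α s i * rowEntry e f α β (e + i) k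

theorem rowEntry_eq_colEntry {k : ℕ} (hk : e + f ≤ k + 1) (t : ℕ) :
    rowEntry e f α β t k = colEntry e f α β (k + 1 - (e + f)) t := by
  rw [rowEntry]
  split_ifs with h h'
  · rw [show k + 1 - (e + f) = 0 by omega, colEntry, if_pos (by omega)]
  · rw [show k + 1 - (e + f) = 0 by omega, colEntry, if_neg (by omega)]
  · rfl

/-- This is J N₁ ⊆ N₂ in coordinates; the recursion in `colEntry` is this identity solved for row s
+ 1. The term i + 1 = f is absent because the shift moves its pivot out of the identity block. -/
theorem subEntry_eq_shift {s : ℕ} (hs : s < e) (k : ℕ) :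
    subEntry e f α β s k = rowEntry e f α β (s + 1) (k + 1) + ∑ i ∈ Finset.range f,
      α s i * if i + 1 < f then rowEntry e f α β (e + (i + 1)) (k + 1) else 0 := by
  rw [subEntry]
  rcases lt_or_ge (k + 1) (e + f) with hk | hk
  · have hk' : k < e + f := by omega
    simp only [rowEntry, if_pos hk, if_pos hk', Nat.add_right_cancel_iff]
    congr 1
    refine Finset.sum_congr rfl fun i hi => ?_
    rw [Finset.mem_range] at hi
    congr 1
    split_ifs <;> first | rfl | omega
  · rw [rowEntry_eq_colEntry _ _ _ _ hk, rowEntry_eq_colEntry _ _ _ _ (by omega : e + f ≤ k + 1 + 1),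
      show k + 1 + 1 - (e + f) = (k + 1 - (e + f)) + 1 by omega, colEntry,
      if_neg (by omega), if_pos (by omega), Nat.add_sub_cancel, add_assoc,
      ← Finset.sum_add_distrib]
    congr 1
    refine Finset.sum_congr rfl fun i hi => ?_
    rw [← mul_add]
    congr 1
    rw [rowEntry_eq_colEntry _ _ _ _ hk, rowEntry_eq_colEntry _ _ _ _ (by omega : e + f ≤ k + 1 + 1),
      show k + 1 + 1 - (e + f) = (k + 1 - (e + f)) + 1 by omega]
    split_ifs with h
    · rw [colEntry, if_neg (by omega), if_neg (by omega), show e + (i + 1) - e = i + 1 by omega]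
      ring
    · ring

/-- Compatibility with ring maps lets the entries be computed once over the polynomial ring and then
evaluated, so the family has polynomial Plücker coordinates. -/
theorem map_colEntry {R' : Type*} [CommRing R'] (φ : R →+* R') (k : ℕ) : ∀ t,
    φ (colEntry e f α β k t) = colEntry e f (fun i j => φ (α i j)) (fun i j => φ (β i j)) k t := by
  induction k with
  | zero => intro t; simp only [colEntry]; split_ifs <;> simp
  | succ k ih =>
    intro t
    simp only [colEntry]
    split_ifs
    · rfl
    · simp only [map_add, map_sum, map_mul, map_sub, ih]
      congr 1
      refine Finset.sum_congr rfl fun i _ => ?_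
      split_ifs <;> simp
    · rfl

theorem map_rowEntry {R' : Type*} [CommRing R'] (φ : R →+* R') (t k : ℕ) :
    φ (rowEntry e f α β t k) = rowEntry e f (fun i j => φ (α i j)) (fun i j => φ (β i j)) t k := by
  simp only [rowEntry]
  split_ifs
  · exact map_one φ
  · exact map_zero φ
  · exact map_colEntry e f α β φ _ _

theorem map_subEntry {R' : Type*} [CommRing R'] (φ : R →+* R') (t k : ℕ) :
    φ (subEntry e f α β t k) = subEntry e f (fun i j => φ (α i j)) (fun i j => φ (β i j)) t k := by
  simp only [subEntry, map_add, map_sum, map_mul, map_rowEntry]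

theorem rowEntry_of_lt {k : ℕ} (hk : k < e + f) (t : ℕ) :
    rowEntry e f α β t k = if t = k then 1 else 0 := if_pos hk

theorem subEntry_of_lt {k : ℕ} (hk : k < e) (s : ℕ) :
    subEntry e f α β s k = if s = k then 1 else 0 := by
  rw [subEntry, rowEntry_of_lt _ _ _ _ (by omega), Finset.sum_eq_zero, add_zero]
  intro i _
  rw [rowEntry_of_lt _ _ _ _ (by omega), if_neg (by omega), mul_zero]

theorem subEntry_param {s i : ℕ} (hs : s < e) (hi : i < f) :
    subEntry e f α β s (e + i) = α s i := by
  rw [subEntry, rowEntry_of_lt _ _ _ _ (by omega), if_neg (by omega), zero_add,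
    Finset.sum_eq_single i]
  · rw [rowEntry_of_lt _ _ _ _ (by omega), if_pos rfl, mul_one]
  · intro j _ hj
    rw [rowEntry_of_lt _ _ _ _ (by omega), if_neg (by omega), mul_zero]
  · intro h
    exact absurd (Finset.mem_range.mpr hi) h

theorem rowEntry_param (i k : ℕ) :
    rowEntry e f α β (if i = 0 then 0 else e + i) (e + f + k) = β i k := by
  rw [rowEntry, if_neg (by omega), show e + f + k + 1 - (e + f) = k + 1 by omega, colEntry]
  by_cases hi : i = 0
  · simp [hi]
  · rw [if_neg hi, if_neg (by omega), if_neg (by omega), Nat.add_sub_cancel_left]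

end Entries

section Minor

variable {n e : ℕ}

theorem exists_orderEmbedding_minor (ι : Fin e → Fin n) (hι : Function.Injective ι) :
    ∃ I : Fin e ↪o Fin n, ∀ v : Fin e → Fin n → ℂ,
      (Matrix.of fun i j : Fin e => v j (I i)).det = 0 ↔
        (Matrix.of fun i j : Fin e => v j (ι i)).det = 0 := by
  refine ⟨OrderEmbedding.ofStrictMono (ι ∘ Tuple.sort ι) ((Tuple.monotone_sort ι).strictMono_of_injective
    (hι.comp (Tuple.sort ι).injective)), fun v => ?_⟩
  have := Matrix.det_permute (Tuple.sort ι) (Matrix.of fun i j : Fin e => v j (ι i))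
  change ((Matrix.of fun i j : Fin e => v j (ι i)).submatrix (Tuple.sort ι) id).det = 0 ↔ _
  rw [this]
  simp

/-- An entry of a matrix with an identity block is, up to sign, a maximal minor. -/
theorem exists_minor_eq_zero_iff (he : e ≤ n) (s : Fin e) (k : Fin n) (hk : e ≤ k) :
    ∃ I : Fin e ↪o Fin n, ∀ v : Fin e → Fin n → ℂ,
      (∀ i j, v i (Fin.castLE he j) = if i = j then 1 else 0) →
      ((Matrix.of fun i j : Fin e => v j (I i)).det = 0 ↔ v s k = 0) := by
  -- The minor uses the identity rows with the `s`-th one replaced by position `k`; sorting these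
  -- positions costs only a sign.
  have hι : Function.Injective (Function.update (Fin.castLE he) s k) := by
    intro i j h
    have hne : ∀ l : Fin e, Fin.castLE he l ≠ k := fun l hl => by
      have := congrArg Fin.val hl
      simp only [Fin.val_castLE] at this
      omega
    by_cases hi : i = s <;> by_cases hj : j = s
    · rw [hi, hj]
    · subst hi
      rw [Function.update_self, Function.update_of_ne hj] at h
      exact absurd h.symm (hne j)
    · subst hj
      rw [Function.update_self, Function.update_of_ne hi] at h
      exact absurd h (hne i)
    · rw [Function.update_of_ne hi, Function.update_of_ne hj] at h
      exact Fin.castLE_injective he h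
  obtain ⟨I, hI⟩ := exists_orderEmbedding_minor _ hι
  refine ⟨I, fun v hv => ?_⟩
  rw [hI v]
  have hM : (Matrix.of fun i j : Fin e => v j (Function.update (Fin.castLE he) s k i)) =
      ((1 : Matrix (Fin e) (Fin e) ℂ).updateCol s fun j => v j k).transpose := by
    ext i j
    rw [Matrix.of_apply, Matrix.transpose_apply, Matrix.updateCol_apply]
    split_ifs with h
    · rw [h, Function.update_self]
    · rw [Function.update_of_ne h, hv, Matrix.one_apply]
  rw [hM, Matrix.det_transpose, ← Matrix.cramer_apply, Matrix.cramer_one]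
  rfl

end Minor

section Family

/-- The index type of the parameters of the family of subrepresentations. -/
abbrev ParamIndex (e f m : ℕ) : Type := (Fin e × Fin f) ⊕ (Fin f × Fin m)

variable {e f m : ℕ} {R : Type*} [CommRing R]

/-- The first group of parameters, extended by zero. -/
def paramLeft (x : ParamIndex e f m → R) (i j : ℕ) : R :=
  if h : i < e ∧ j < f then x (Sum.inl (⟨i, h.1⟩, ⟨j, h.2⟩)) else 0

/-- The second group of parameters, extended by zero. -/
def paramRight (x : ParamIndex e f m → R) (i j : ℕ) : R :=
  if h : i < f ∧ j < m then x (Sum.inr (⟨i, h.1⟩, ⟨j, h.2⟩)) else 0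

theorem map_paramLeft {R' : Type*} [CommRing R'] (φ : R →+* R') (x : ParamIndex e f m → R)
    (i j : ℕ) : φ (paramLeft x i j) = paramLeft (fun t => φ (x t)) i j := by
  simp only [paramLeft]
  split_ifs
  exacts [rfl, map_zero φ]

theorem map_paramRight {R' : Type*} [CommRing R'] (φ : R →+* R') (x : ParamIndex e f m → R)
    (i j : ℕ) : φ (paramRight x i j) = paramRight (fun t => φ (x t)) i j := by
  simp only [paramRight]
  split_ifs
  exacts [rfl, map_zero φ]

/-- The vectors that span the second subspace of a member of the family. -/
def rowVec (n : ℕ) (x : ParamIndex e f m → ℂ) (t : ℕ) : Fin n → ℂ :=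
  fun k => rowEntry e f (paramLeft x) (paramRight x) t k

/-- The vectors that span the first subspace of a member of the family. -/
def subVec (n : ℕ) (x : ParamIndex e f m → ℂ) (s : ℕ) : Fin n → ℂ :=
  fun k => subEntry e f (paramLeft x) (paramRight x) s k

theorem rowVec_eq_eval (n : ℕ) (x : ParamIndex e f m → ℂ) (t : ℕ) (k : Fin n) :
    rowVec n x t k = MvPolynomial.eval x (rowEntry e f (paramLeft (m := m) MvPolynomial.X)
      (paramRight MvPolynomial.X) t k) := by
  simp only [map_rowEntry, map_paramLeft, map_paramRight, MvPolynomial.eval_X, rowVec]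

theorem subVec_eq_eval (n : ℕ) (x : ParamIndex e f m → ℂ) (t : ℕ) (k : Fin n) :
    subVec n x t k = MvPolynomial.eval x (subEntry e f (paramLeft (m := m) MvPolynomial.X)
      (paramRight MvPolynomial.X) t k) := by
  simp only [map_subEntry, map_paramLeft, map_paramRight, MvPolynomial.eval_X, subVec]

theorem subVec_mem_span (n : ℕ) (x : ParamIndex e f m → ℂ) {s : ℕ} (hs : s < e) :
    subVec n x s ∈ Submodule.span ℂ (Set.range fun t : Fin (e + f) => rowVec n x t) := by
  have hrow : ∀ t, t < e + f →
      rowVec n x t ∈ Submodule.span ℂ (Set.range fun t : Fin (e + f) => rowVec n x t) :=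
    fun t ht => Submodule.subset_span ⟨⟨t, ht⟩, rfl⟩
  have : subVec n x s = rowVec n x s +
      ∑ i ∈ Finset.range f, paramLeft x s i • rowVec n x (e + i) := by
    funext k
    simp only [Pi.add_apply, Finset.sum_apply, Pi.smul_apply, smul_eq_mul]
    rfl
  rw [this]
  refine Submodule.add_mem _ (hrow s (by omega)) (Submodule.sum_mem _ fun i hi => ?_)
  rw [Finset.mem_range] at hi
  exact Submodule.smul_mem _ _ (hrow _ (by omega))

theorem nilpotentJordan_subVec_mem_span (n : ℕ) (x : ParamIndex e f m → ℂ) (hf : 0 < f) {s : ℕ}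
    (hs : s < e) : Matrix.toLin' (nilpotentJordan n) (subVec n x s) ∈
      Submodule.span ℂ (Set.range fun t : Fin (e + f) => rowVec n x t) := by
  have hrow : ∀ t, t < e + f →
      rowVec n x t ∈ Submodule.span ℂ (Set.range fun t : Fin (e + f) => rowVec n x t) :=
    fun t ht => Submodule.subset_span ⟨⟨t, ht⟩, rfl⟩
  have : Matrix.toLin' (nilpotentJordan n) (subVec n x s) = rowVec n x (s + 1) +
      ∑ i ∈ Finset.range f, paramLeft x s i •
        if i + 1 < f then rowVec n x (e + (i + 1)) else 0 := by
    funext k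
    simp only [Pi.add_apply, Finset.sum_apply, Pi.smul_apply, smul_eq_mul, ite_apply,
      Pi.zero_apply]
    by_cases hk : (k : ℕ) = 0
    · rw [nilpotentJordan_apply_zero _ _ hk, Finset.sum_eq_zero, add_zero, rowVec, hk,
        rowEntry_of_lt _ _ _ _ (by omega), if_neg (by omega)]
      intro i _
      split_ifs
      · rw [rowVec, hk, rowEntry_of_lt _ _ _ _ (by omega), if_neg (by omega), mul_zero]
      · rw [mul_zero]
    · rw [nilpotentJordan_apply_succ _ k ⟨k - 1, by omega⟩ (by simp only; omega)]
      refine (subEntry_eq_shift e f _ _ hs _).trans ?_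
      simp only [show (k : ℕ) - 1 + 1 = k by omega]
      rfl
  rw [this]
  refine Submodule.add_mem _ (hrow _ (by omega)) (Submodule.sum_mem _ fun i _ => ?_)
  refine Submodule.smul_mem _ _ ?_
  split_ifs
  · exact hrow _ (by omega)
  · exact Submodule.zero_mem _

theorem rowVec_castLE {n : ℕ} (h : e + f ≤ n) (x : ParamIndex e f m → ℂ) (i j : Fin (e + f)) :
    rowVec n x i (Fin.castLE h j) = if i = j then 1 else 0 := by
  rw [rowVec, Fin.val_castLE, rowEntry_of_lt _ _ _ _ j.2]
  simp only [Fin.ext_iff]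

theorem subVec_castLE {n : ℕ} (h : e ≤ n) (x : ParamIndex e f m → ℂ) (i j : Fin e) :
    subVec n x i (Fin.castLE h j) = if i = j then 1 else 0 := by
  rw [subVec, Fin.val_castLE, subEntry_of_lt _ _ _ _ j.2]
  simp only [Fin.ext_iff]

theorem linearIndependent_rowVec {n : ℕ} (h : e + f ≤ n) (x : ParamIndex e f m → ℂ) :
    LinearIndependent ℂ fun t : Fin (e + f) => rowVec n x t :=
  linearIndependent_of_pivot (Fin.castLE h) _ (rowVec_castLE h x)

theorem linearIndependent_subVec {n : ℕ} (h : e ≤ n) (x : ParamIndex e f m → ℂ) :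
    LinearIndependent ℂ fun s : Fin e => subVec n x s :=
  linearIndependent_of_pivot (Fin.castLE h) _ (subVec_castLE h x)

/-- A family of subrepresentations of the regular representation, parametrized by an affine
space. -/
def family {n : ℕ} (h : e + f ≤ n) (hf : 0 < f) (x : ParamIndex e f m → ℂ) :
    quiverGrassmannian (regularRep n) e (e + f) where
  val :=
    { N₁ := Submodule.span ℂ (Set.range fun s : Fin e => subVec n x s)
      N₂ := Submodule.span ℂ (Set.range fun t : Fin (e + f) => rowVec n x t)
      finrank_N₁ := by
        simpa using finrank_span_eq_card (linearIndependent_subVec (by omega) x)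
      finrank_N₂ := by simpa using finrank_span_eq_card (linearIndependent_rowVec h x) }
  property := by
    constructor
    · refine fun u hu => (Submodule.span_le.mpr ?_ : _ ≤
        (Submodule.span ℂ (Set.range fun t : Fin (e + f) => rowVec n x t))) hu
      rintro _ ⟨s, rfl⟩
      exact subVec_mem_span n x s.2
    · refine fun u hu => (Submodule.span_le.mpr ?_ : _ ≤
        (Submodule.span ℂ (Set.range fun t : Fin (e + f) => rowVec n x t)).comap
          (Matrix.toLin' (nilpotentJordan n))) hu
      rintro _ ⟨s, rfl⟩
      exact nilpotentJordan_subVec_mem_span n x hf s.2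

/-- The polynomials that express the Plücker coordinates of the family. -/
noncomputable def familyPlucker (e f m n : ℕ) : (Fin e ↪o Fin n) ⊕ (Fin (e + f) ↪o Fin n) →
    MvPolynomial (ParamIndex e f m) ℂ :=
  Sum.elim
    (fun I => (Matrix.of fun i j : Fin e => subEntry e f (paramLeft (m := m) MvPolynomial.X)
      (paramRight MvPolynomial.X) j (I i)).det)
    (fun I => (Matrix.of fun i j : Fin (e + f) => rowEntry e f
      (paramLeft (m := m) MvPolynomial.X) (paramRight MvPolynomial.X) j (I i)).det)

theorem eval_familyPlucker_inl {n : ℕ} (x : ParamIndex e f m → ℂ) (I : Fin e ↪o Fin n) :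
    MvPolynomial.eval x (familyPlucker e f m n (Sum.inl I)) =
      (Matrix.of fun i j : Fin e => subVec n x j (I i)).det := by
  rw [familyPlucker, Sum.elim_inl, RingHom.map_det]
  congr 1
  ext i j
  exact (subVec_eq_eval n x j (I i)).symm

theorem eval_familyPlucker_inr {n : ℕ} (x : ParamIndex e f m → ℂ) (I : Fin (e + f) ↪o Fin n) :
    MvPolynomial.eval x (familyPlucker e f m n (Sum.inr I)) =
      (Matrix.of fun i j : Fin (e + f) => rowVec n x j (I i)).det := by
  rw [familyPlucker, Sum.elim_inr, RingHom.map_det]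
  congr 1
  ext i j
  exact (rowVec_eq_eval n x j (I i)).symm

theorem family_mem_nonvanishingLocus_iff {n : ℕ} (h : e + f ≤ n) (hf : 0 < f)
    (x : ParamIndex e f m → ℂ)
    {F : MvPolynomial ((Fin e ↪o Fin n) ⊕ (Fin (e + f) ↪o Fin n)) ℂ} {p q : ℕ}
    (hF : IsBihomogeneous F p q) :
    (family h hf x : GrassmannianPair n n e (e + f)) ∈ nonvanishingLocus F ↔
      MvPolynomial.eval x (MvPolynomial.bind₁ (familyPlucker e f m n) F) ≠ 0 := by
  obtain ⟨v, hv⟩ : ∃ v : Module.Basis (Fin e) ℂ (family h hf x).1.N₁,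
      ∀ j, (v j : Fin n → ℂ) = subVec n x j :=
    ⟨Module.Basis.span (linearIndependent_subVec (by omega : e ≤ n) x), fun j =>
      congrArg Subtype.val
        (Module.Basis.span_apply (linearIndependent_subVec (by omega : e ≤ n) x) j)⟩
  obtain ⟨w, hw⟩ : ∃ w : Module.Basis (Fin (e + f)) ℂ (family h hf x).1.N₂,
      ∀ j, (w j : Fin n → ℂ) = rowVec n x j :=
    ⟨Module.Basis.span (linearIndependent_rowVec h x), fun j =>
      congrArg Subtype.val (Module.Basis.span_apply (linearIndependent_rowVec h x) j)⟩
  have hpt : (fun i => MvPolynomial.eval x (familyPlucker e f m n i)) =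
      Sum.elim (plucker v) (plucker w) := by
    funext i
    cases i with
    | inl I =>
      rw [eval_familyPlucker_inl, Sum.elim_inl, plucker]
      simp only [hv]
    | inr I =>
      rw [eval_familyPlucker_inr, Sum.elim_inr, plucker]
      simp only [hw]
  have hev : MvPolynomial.eval x (MvPolynomial.bind₁ (familyPlucker e f m n) F) =
      MvPolynomial.eval (Sum.elim (plucker v) (plucker w)) F := by
    rw [← hpt, ← MvPolynomial.coe_aeval_eq_eval, ← MvPolynomial.coe_aeval_eq_eval, RingHom.coe_coe,
      RingHom.coe_coe, MvPolynomial.aeval_bind₁]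
  rw [hev]
  exact mem_nonvanishingLocus_iff hF _ v w

theorem le_topologicalKrullDim_quiverGrassmannian {n : ℕ} (h : e + f ≤ n) (hf : 0 < f) :
    ((f * (n - f) : ℕ) : WithBot ℕ∞) ≤
      topologicalKrullDim (quiverGrassmannian (regularRep n) e (e + f)) := by
  have hcard : Fintype.card (ParamIndex e f (n - (e + f))) = f * (n - f) := by
    simp only [Fintype.card_sum, Fintype.card_prod, Fintype.card_fin]
    rw [mul_comm e, ← mul_add]
    congr 1
    omega
  rw [← hcard]
  refine le_topologicalKrullDim_of_fintype_param (family h hf) (fun O hO x hx => ?_) fun j => ?_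
  · obtain ⟨O', hO', rfl⟩ := isOpen_induced_iff.mp hO
    obtain ⟨p, q, F, hF, hxF, hsub⟩ := exists_nonvanishingLocus_subset hO' hx
    exact ⟨_, (family_mem_nonvanishingLocus_iff h hf x hF).mp hxF, fun y hy =>
      hsub ((family_mem_nonvanishingLocus_iff h hf y hF).mpr hy)⟩
  · cases j with
    | inl j =>
      obtain ⟨s, i⟩ := j
      obtain ⟨I, hI⟩ := exists_minor_eq_zero_iff (by omega : e ≤ n) s ⟨e + i, by omega⟩
        (by simp)
      have hX := isBihomogeneous_X_inl (τ := Fin (e + f) ↪o Fin n) I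
      refine ⟨(Subtype.val ⁻¹' nonvanishingLocus (MvPolynomial.X (Sum.inl I)))ᶜ,
        ((isOpen_nonvanishingLocus hX).preimage continuous_subtype_val).isClosed_compl,
        fun x => ?_⟩
      rw [Set.mem_compl_iff, Set.mem_preimage, family_mem_nonvanishingLocus_iff h hf x hX, not_not,
        MvPolynomial.bind₁_X_right, eval_familyPlucker_inl,
        hI (fun s => subVec n x s) (subVec_castLE _ x), subVec]
      simp only
      rw [subEntry_param _ _ _ _ s.2 i.2, paramLeft, dif_pos ⟨s.2, i.2⟩]
    | inr j =>
      obtain ⟨i, k⟩ := j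
      -- The parameter (i, k) sits in row 0 if i = 0 and in row e + i otherwise, in the k-th column
      -- after the identity block.
      obtain ⟨I, hI⟩ := exists_minor_eq_zero_iff h ⟨if (i : ℕ) = 0 then 0 else e + i, by
        split_ifs <;> omega⟩ ⟨e + f + k, by omega⟩ (by simp)
      have hX := isBihomogeneous_X_inr (σ := Fin e ↪o Fin n) I
      refine ⟨(Subtype.val ⁻¹' nonvanishingLocus (MvPolynomial.X (Sum.inr I)))ᶜ,
        ((isOpen_nonvanishingLocus hX).preimage continuous_subtype_val).isClosed_compl,
        fun x => ?_⟩
      rw [Set.mem_compl_iff, Set.mem_preimage, family_mem_nonvanishingLocus_iff h hf x hX, not_not,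
        MvPolynomial.bind₁_X_right, eval_familyPlucker_inr,
        hI (fun s => rowVec n x s) (rowVec_castLE _ x), rowVec]
      simp only
      rw [rowEntry_param, paramRight, dif_pos ⟨i.2, k.2⟩]

end Family

end KroneckerQuiver

theorem mainTheorem10 (n e₁ e₂ : ℕ) (h₁ : e₁ ≤ e₂) (h₂ : e₂ ≤ n) :
    ∃ d : ℕ,
      topologicalKrullDim (KroneckerQuiver.quiverGrassmannian
        (KroneckerQuiver.regularRep n) e₁ e₂) = (d : WithBot ℕ∞) ∧
      (d : ℤ) = KroneckerQuiver.eulerForm ((e₁ : ℤ), (e₂ : ℤ))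
        ((n : ℤ) • KroneckerQuiver.delta - ((e₁ : ℤ), (e₂ : ℤ))) ∧
      KroneckerQuiver.eulerForm ((e₁ : ℤ), (e₂ : ℤ))
        ((n : ℤ) • KroneckerQuiver.delta - ((e₁ : ℤ), (e₂ : ℤ))) =
          ((e₂ : ℤ) - e₁) * (n - ((e₂ : ℤ) - e₁)) := by
  have heuler : KroneckerQuiver.eulerForm ((e₁ : ℤ), (e₂ : ℤ))
      ((n : ℤ) • KroneckerQuiver.delta - ((e₁ : ℤ), (e₂ : ℤ))) =
        ((e₂ : ℤ) - e₁) * (n - ((e₂ : ℤ) - e₁)) := by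
    simp only [KroneckerQuiver.eulerForm, KroneckerQuiver.delta, Prod.smul_mk, Prod.mk_sub_mk,
      smul_eq_mul, mul_one]
    ring
  refine ⟨(e₂ - e₁) * (n - (e₂ - e₁)), le_antisymm
    (KroneckerQuiver.topologicalKrullDim_quiverGrassmannian_le n e₁ e₂) ?_, ?_, heuler⟩
  · obtain ⟨f, rfl⟩ := Nat.exists_eq_add_of_le h₁
    rw [Nat.add_sub_cancel_left]
    -- The family needs f > 0, since row s + 1 with s < e may be row e. For f = 0 the bound is 0 and
    -- nonemptiness is enough.
    rcases Nat.eq_zero_or_pos f with rfl | hf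
    · obtain ⟨x, hx⟩ := KroneckerQuiver.quiverGrassmannian_diagonal_nonempty h₂
      rw [zero_mul]
      exact KroneckerQuiver.le_topologicalKrullDim_of_param 0 (fun _ => ⟨x, hx⟩)
        (fun O _ _ hO => ⟨1, by simp, fun _ _ => hO⟩) fun j => j.elim0
    · exact KroneckerQuiver.le_topologicalKrullDim_quiverGrassmannian h₂ hf
  · rw [heuler, Nat.cast_mul, Nat.cast_sub (by omega : e₂ - e₁ ≤ n), Nat.cast_sub h₁]
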